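/- Let $p,q\ge 1$, $d=p+q$, and write a real symmetric $d\times d$ matrix in blocks as $\Sigma=\begin{bmatrix}\Sigma_1&\Psi\\ \Psi^\top&\Sigma_2\end{bmatrix}$ with $\Sigma_1\in\mathbb R^{p\times p}$, $\Sigma_2\in\mathbb R^{q\times q}$. For a square matrix $A$ let $D_A$ be the diagonal matrix with the diagonal of $A$; for a $d\times d$ matrix $A$ let $A_0$ be $A$ with its two off-diagonal blocks replaced by $0$. For positive semi-definite $\Sigma,\Xi$ let $$d_W^2(\Sigma,\Xi)=\operatorname{tr}\Sigma+\operatorname{tr}\Xi-2\operatorname{tr}\bigl((\Sigma^{1/2}\Xi\Sigma^{1/2})^{1/2}\bigr)$$ be the squared Bures--Wasserstein distance, and let $\Gamma(\Sigma_1,\Sigma_2)$ be the set of positive semi-definite $d\times d$ matrices with diagonal blocks $\Sigma_1,\Sigma_2$. Define $$\mathcal D_1(\Sigma)=\frac{d_W^2(\Sigma,I_d)-d_W^2(\Sigma_1,I_p)-d_W^2(\Sigma_2,I_q)}{\sup_{\tilde\Sigma\in\Gamma(\Sigma_1,\Sigma_2)}d_W^2(\tilde\Sigma,I_d)-d_W^2(\Sigma_1,I_p)-d_W^2(\Sigma_2,I_q)},\qquad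 \mathcal D_2(\Sigma)=\frac{d_W^2(\Sigma,\Sigma_0)}{\sup_{\tilde\Sigma\in\Gamma(\Sigma_1,\Sigma_2)}d_W^2(\tilde\Sigma,\Sigma_0)},$$ and $\varphi(\Sigma)=D_\Sigma^{-1/2}\Sigma D_\Sigma^{-1/2}$ for $\Sigma$ with positive diagonal. Let $R$ be a positive definite $d\times d$ correlation matrix ($D_R=I_d$) with diagonal blocks $R_1,R_2$, such that $R_1$ has $p$ distinct eigenvalues and $R_2$ has $q$ distinct eigenvalues. Let $R_k=U_k\Lambda_kU_k^\top$ ($k=1,2$) be eigendecompositions with $U_k$ orthogonal and $\Lambda_k$ diagonal with the eigenvalues $\lambda_{1,k}\ge\lambda_{2,k}\ge\cdots$ of $R_k$ in decreasing order; put $\lambda_{j,1}=0$ for $j>p$ and $\lambda_{j,2}=0$ for $j>q$. Let $\Pi\in\mathbb R^{p\times q}$ be the upper left $p\times q$ block of $I_d$, $\Psi_m=U_1\Lambda_1^{1/2}\Pi\Lambda_2^{1/2}U_2^\top$, $R_m=\begin{bmatrix}R_1&\Psi_m\\ \Psi_m^\top&R_2\end{bmatrix}$, and $$\Delta_1=\operatorname{diag}\bigl((\lambda_{j,1}+\lambda_{j,2})^{-1/2}\bigr)_{j\le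 p},\quad \Delta_2=\operatorname{diag}\bigl((\lambda_{j,1}+\lambda_{j,2})^{-1/2}\bigr)_{j\le q},$$ $$\Delta_1'=\operatorname{diag}\bigl((\lambda_{j,1}^2+\lambda_{j,2}^2)^{-1/2}\lambda_{j,1}\bigr)_{j\le p},\quad \Delta_2'=\operatorname{diag}\bigl((\lambda_{j,1}^2+\lambda_{j,2}^2)^{-1/2}\lambda_{j,2}\bigr)_{j\le q},$$ $$\Upsilon_1=\begin{bmatrix}U_1\Delta_1U_1^\top&0\\0&U_2\Delta_2U_2^\top\end{bmatrix},\quad \Upsilon_2=\begin{bmatrix}U_1\Delta_1'U_1^\top&0\\0&U_2\Delta_2'U_2^\top\end{bmatrix},\quad J=R_0^{-1/2}\bigl(R_0^{1/2}RR_0^{1/2}\bigr)^{1/2}R_0^{-1/2},$$ $$c_1=\operatorname{tr}(R_1^{1/2})+\operatorname{tr}(R_2^{1/2})-\operatorname{tr}(R_m^{1/2}),\qquad c_2=\operatorname{tr}(R)-\operatorname{tr}\bigl((R_0^{1/2}R_mR_0^{1/2})^{1/2}\bigr),$$ $$M_{R,1}=\frac1{2c_1}\Bigl(-R^{-1/2}+(1-\mathcal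 D_1(R))R_0^{-1/2}+\mathcal D_1(R)\Upsilon_1\Bigr),$$ $$M_{R,2}=\frac1{c_2}\Bigl(-\tfrac12(J_0+J^{-1})+(1-\mathcal D_2(R))I_d+\mathcal D_2(R)\Upsilon_2\Bigr).$$ Then for all symmetric $d\times d$ matrices $H$ and $H_t$ ($t>0$) with $H_t\to H$ element-wise as $t\downarrow0$, and for $r\in\{1,2\}$, $$\lim_{t\downarrow0}t^{-1}\bigl(\mathcal D_r(\varphi(R+tH_t))-\mathcal D_r(R)\bigr)=\operatorname{tr}\bigl((M_{R,r}-D_{M_{R,r}R})H\bigr).$$ -/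

import Mathlib

open Filter Topology
open scoped MatrixOrder

noncomputable section

namespace QGDep

/-- The positive semi-definite square root `A^{1/2}` of a positive semi-definite real matrix
(Mathlib's square root of a nonnegative element, for the Loewner order). -/
def msqrt {n : Type} [Fintype n] [DecidableEq n] (A : Matrix n n ℝ) : Matrix n n ℝ :=
  CFC.sqrt A

/-- The squared Bures--Wasserstein distance
`tr Σ + tr Ξ - 2 tr ((Σ^{1/2} Ξ Σ^{1/2})^{1/2})` of positive semi-definite matrices. -/
def dW2 {n : Type} [Fintype n] [DecidableEq n] (S X : Matrix n n ℝ) : ℝ :=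
  S.trace + X.trace - 2 * (msqrt (msqrt S * X * msqrt S)).trace

/-- `D_A`, the diagonal matrix with the same diagonal as `A`. -/
def diagPart {n : Type} [DecidableEq n] (A : Matrix n n ℝ) : Matrix n n ℝ :=
  Matrix.diagonal A.diag

/-- `φ(Σ) = D_Σ^{-1/2} Σ D_Σ^{-1/2}`, the correlation matrix of a covariance matrix. -/
def toCorr {n : Type} [Fintype n] [DecidableEq n] (S : Matrix n n ℝ) : Matrix n n ℝ :=
  Matrix.diagonal (fun i => (Real.sqrt (S i i))⁻¹) * S *
    Matrix.diagonal (fun i => (Real.sqrt (S i i))⁻¹)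

/-- An eigendecomposition `A = U diag(l) Uᵀ` with `U` orthogonal and the eigenvalues `l`
in decreasing order, counting multiplicities. -/
structure IsOrderedEigendecomp {n : ℕ} (A U : Matrix (Fin n) (Fin n) ℝ) (l : Fin n → ℝ) :
    Prop where
  orthogonal : U ∈ Matrix.orthogonalGroup (Fin n) ℝ
  antitone : Antitone l
  eq : A = U * Matrix.diagonal l * U.transpose

/-- The vector `l` extended by zeros: entry `j` (counted from `0`) if `j < n`, and `0` beyond. -/
def pad {n : ℕ} (l : Fin n → ℝ) (j : ℕ) : ℝ :=
  if h : j < n then l ⟨j, h⟩ else 0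

variable {p q : ℕ}

/-- `Γ(Σ₁, Σ₂)`: the positive semi-definite matrices with diagonal blocks `Σ₁` and `Σ₂`. -/
def Coupling (S₁ : Matrix (Fin p) (Fin p) ℝ) (S₂ : Matrix (Fin q) (Fin q) ℝ) :
    Set (Matrix (Fin p ⊕ Fin q) (Fin p ⊕ Fin q) ℝ) :=
  {S | S.PosSemidef ∧ ∃ Y : Matrix (Fin p) (Fin q) ℝ, S = Matrix.fromBlocks S₁ Y Y.transpose S₂}

/-- `A₀`: the matrix `A` with its off-diagonal blocks replaced by zero. -/
def blockDiagPart (A : Matrix (Fin p ⊕ Fin q) (Fin p ⊕ Fin q) ℝ) :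
    Matrix (Fin p ⊕ Fin q) (Fin p ⊕ Fin q) ℝ :=
  Matrix.fromBlocks A.toBlocks₁₁ 0 0 A.toBlocks₂₂

/-- The first quasi-Gaussian Wasserstein dependence coefficient of `Σ`. -/
def dep₁ (S : Matrix (Fin p ⊕ Fin q) (Fin p ⊕ Fin q) ℝ) : ℝ :=
  (dW2 S 1 - dW2 S.toBlocks₁₁ 1 - dW2 S.toBlocks₂₂ 1) /
    (sSup ((fun T => dW2 T 1) '' Coupling S.toBlocks₁₁ S.toBlocks₂₂)
      - dW2 S.toBlocks₁₁ 1 - dW2 S.toBlocks₂₂ 1)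

/-- The second quasi-Gaussian Wasserstein dependence coefficient of `Σ`. -/
def dep₂ (S : Matrix (Fin p ⊕ Fin q) (Fin p ⊕ Fin q) ℝ) : ℝ :=
  dW2 S (blockDiagPart S) /
    sSup ((fun T => dW2 T (blockDiagPart S)) '' Coupling S.toBlocks₁₁ S.toBlocks₂₂)

/-- `Ψ_m = U₁ Λ₁^{1/2} Π Λ₂^{1/2} U₂ᵀ`, with `Π` the `p × q` upper left block of the identity. -/
def PsiMax (U₁ : Matrix (Fin p) (Fin p) ℝ) (l₁ : Fin p → ℝ)
    (U₂ : Matrix (Fin q) (Fin q) ℝ) (l₂ : Fin q → ℝ) : Matrix (Fin p) (Fin q) ℝ :=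
  U₁ * Matrix.diagonal (fun i => Real.sqrt (l₁ i)) *
    Matrix.of (fun (i : Fin p) (j : Fin q) => if (i : ℕ) = (j : ℕ) then (1 : ℝ) else 0) *
    Matrix.diagonal (fun j => Real.sqrt (l₂ j)) * U₂.transpose

/-- `Σ_m`: the matrix with the diagonal blocks of `Σ` and off-diagonal block `Ψ_m`. -/
def SigmaMax (S : Matrix (Fin p ⊕ Fin q) (Fin p ⊕ Fin q) ℝ)
    (U₁ : Matrix (Fin p) (Fin p) ℝ) (l₁ : Fin p → ℝ)
    (U₂ : Matrix (Fin q) (Fin q) ℝ) (l₂ : Fin q → ℝ) :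
    Matrix (Fin p ⊕ Fin q) (Fin p ⊕ Fin q) ℝ :=
  Matrix.fromBlocks S.toBlocks₁₁ (PsiMax U₁ l₁ U₂ l₂) (PsiMax U₁ l₁ U₂ l₂).transpose S.toBlocks₂₂

/-- The diagonal matrix `Δ` of size `n`, with `j`-th entry `(λ_{j,1} + λ_{j,2})^{-1/2}`, where the
eigenvalue vectors are extended by zeros. For `p ≤ q` and `n = p` this is
`Δ₁ = (Λ₁ + Λ_{2,1})^{-1/2}`, and for `n = q` it is `Δ₂`, with blocks `Δ₁` and `Λ_{2,2}^{-1/2}`;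
for `p > q` the roles of the two groups are exchanged. -/
def Delta (n : ℕ) (l₁ : Fin p → ℝ) (l₂ : Fin q → ℝ) : Matrix (Fin n) (Fin n) ℝ :=
  Matrix.diagonal (fun j => (Real.sqrt (pad l₁ j + pad l₂ j))⁻¹)

/-- `Δ₁'`, with `j`-th diagonal entry `(λ_{j,1}² + λ_{j,2}²)^{-1/2} λ_{j,1}`. -/
def Delta₁' (l₁ : Fin p → ℝ) (l₂ : Fin q → ℝ) : Matrix (Fin p) (Fin p) ℝ :=
  Matrix.diagonal (fun j => (Real.sqrt (pad l₁ j ^ 2 + pad l₂ j ^ 2))⁻¹ * pad l₁ j)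

/-- `Δ₂'`, with `j`-th diagonal entry `(λ_{j,1}² + λ_{j,2}²)^{-1/2} λ_{j,2}`
(which is `1` for `j > p`). -/
def Delta₂' (l₁ : Fin p → ℝ) (l₂ : Fin q → ℝ) : Matrix (Fin q) (Fin q) ℝ :=
  Matrix.diagonal (fun j => (Real.sqrt (pad l₁ j ^ 2 + pad l₂ j ^ 2))⁻¹ * pad l₂ j)

/-- `Υ₁`, with diagonal blocks `U₁ Δ₁ U₁ᵀ` and `U₂ Δ₂ U₂ᵀ`. -/
def Upsilon₁ (U₁ : Matrix (Fin p) (Fin p) ℝ) (l₁ : Fin p → ℝ)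
    (U₂ : Matrix (Fin q) (Fin q) ℝ) (l₂ : Fin q → ℝ) :
    Matrix (Fin p ⊕ Fin q) (Fin p ⊕ Fin q) ℝ :=
  Matrix.fromBlocks (U₁ * Delta p l₁ l₂ * U₁.transpose) 0 0 (U₂ * Delta q l₁ l₂ * U₂.transpose)

/-- `Υ₂`, with diagonal blocks `U₁ Δ₁' U₁ᵀ` and `U₂ Δ₂' U₂ᵀ`. -/
def Upsilon₂ (U₁ : Matrix (Fin p) (Fin p) ℝ) (l₁ : Fin p → ℝ)
    (U₂ : Matrix (Fin q) (Fin q) ℝ) (l₂ : Fin q → ℝ) :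
    Matrix (Fin p ⊕ Fin q) (Fin p ⊕ Fin q) ℝ :=
  Matrix.fromBlocks (U₁ * Delta₁' l₁ l₂ * U₁.transpose) 0 0 (U₂ * Delta₂' l₁ l₂ * U₂.transpose)

/-- `c₁ = tr(Σ₁^{1/2}) + tr(Σ₂^{1/2}) - tr(Σ_m^{1/2})`. -/
def c₁ (S : Matrix (Fin p ⊕ Fin q) (Fin p ⊕ Fin q) ℝ)
    (U₁ : Matrix (Fin p) (Fin p) ℝ) (l₁ : Fin p → ℝ)
    (U₂ : Matrix (Fin q) (Fin q) ℝ) (l₂ : Fin q → ℝ) : ℝ :=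
  (msqrt S.toBlocks₁₁).trace + (msqrt S.toBlocks₂₂).trace - (msqrt (SigmaMax S U₁ l₁ U₂ l₂)).trace

/-- `c₂ = tr(Σ) - tr((Σ₀^{1/2} Σ_m Σ₀^{1/2})^{1/2})`. -/
def c₂ (S : Matrix (Fin p ⊕ Fin q) (Fin p ⊕ Fin q) ℝ)
    (U₁ : Matrix (Fin p) (Fin p) ℝ) (l₁ : Fin p → ℝ)
    (U₂ : Matrix (Fin q) (Fin q) ℝ) (l₂ : Fin q → ℝ) : ℝ :=
  S.trace - (msqrt (msqrt (blockDiagPart S) * SigmaMax S U₁ l₁ U₂ l₂ *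
    msqrt (blockDiagPart S))).trace

/-- `J = Σ₀^{-1/2} (Σ₀^{1/2} Σ Σ₀^{1/2})^{1/2} Σ₀^{-1/2}`. -/
def Jmat (S : Matrix (Fin p ⊕ Fin q) (Fin p ⊕ Fin q) ℝ) :
    Matrix (Fin p ⊕ Fin q) (Fin p ⊕ Fin q) ℝ :=
  (msqrt (blockDiagPart S))⁻¹ *
    msqrt (msqrt (blockDiagPart S) * S * msqrt (blockDiagPart S)) *
    (msqrt (blockDiagPart S))⁻¹

/-- `M₁ = (1 / (2 c₁)) (-Σ^{-1/2} + (1 - dep₁ Σ) Σ₀^{-1/2} + dep₁ Σ • Υ₁)`. -/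
def M₁ (S : Matrix (Fin p ⊕ Fin q) (Fin p ⊕ Fin q) ℝ)
    (U₁ : Matrix (Fin p) (Fin p) ℝ) (l₁ : Fin p → ℝ)
    (U₂ : Matrix (Fin q) (Fin q) ℝ) (l₂ : Fin q → ℝ) :
    Matrix (Fin p ⊕ Fin q) (Fin p ⊕ Fin q) ℝ :=
  (1 / (2 * c₁ S U₁ l₁ U₂ l₂)) •
    (-(msqrt S)⁻¹ + (1 - dep₁ S) • (msqrt (blockDiagPart S))⁻¹ + dep₁ S • Upsilon₁ U₁ l₁ U₂ l₂)

/-- `M₂ = (1 / c₂) (-(1/2) (J₀ + J⁻¹) + (1 - dep₂ Σ) I + dep₂ Σ • Υ₂)`. -/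
def M₂ (S : Matrix (Fin p ⊕ Fin q) (Fin p ⊕ Fin q) ℝ)
    (U₁ : Matrix (Fin p) (Fin p) ℝ) (l₁ : Fin p → ℝ)
    (U₂ : Matrix (Fin q) (Fin q) ℝ) (l₂ : Fin q → ℝ) :
    Matrix (Fin p ⊕ Fin q) (Fin p ⊕ Fin q) ℝ :=
  (1 / c₂ S U₁ l₁ U₂ l₂) •
    (-((1 / 2 : ℝ) • (blockDiagPart (Jmat S) + (Jmat S)⁻¹)) +
      (1 - dep₂ S) • (1 : Matrix (Fin p ⊕ Fin q) (Fin p ⊕ Fin q) ℝ) +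
      dep₂ S • Upsilon₂ U₁ l₁ U₂ l₂)

end QGDep

end

namespace QGDep

/-! Both coefficients reduce to quotients of differentiable scalar functions, to which the quotient
rule and the chain rule for the map to correlation matrices apply.

The suprema are explicit. Membership in `Coupling` fixes the trace, so maximising the distance means
minimising a trace of a square root. If a positive semi-definite `T` has diagonal blocks with
ordered eigenvalues `l₁`, `l₂`, then `sum_sqrt_pad_le_trace_msqrt` bounds `tr T^{1/2}` below by the
sum of the square roots of the aligned sums `pad l₁ j + pad l₂ j`. The proof combines concavity of
the square root with a rearrangement inequality from Birkhoff's theorem. `SigmaMax` attains the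
bound, since it factors as `Y Yᵀ` with `Yᵀ Y` diagonal with these sums as entries. For the second
coefficient, conjugation by the root of the block diagonal part squares the diagonal blocks, so the
same bound applies to squared eigenvalues. Hence `dep₁_eq` and `dep₂_eq`.

Three kinds of terms must then be differentiated. The fidelity is the minimum over positive definite
`X` of `(tr XA + tr X⁻¹B)/2`, attained at the transport map (`fidelity_le`, `fidelity_eq`); an
envelope argument (`tendsto_slope_fidelity`) differentiates it without differentiating any matrix
square root, and `A = 1` covers `tr B^{1/2}`. Simple eigenvalues have derivative `uᵀ A' u`
(`tendsto_slope_eigenvalue`), which is where distinctness of the spectra enters; summed over a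
block, these produce the matrices `Upsilon₁` and `Upsilon₂`. Finally, normalisation to a correlation
matrix has an explicit entrywise derivative, and symmetry of `M₁` and `M₂` turns it into the
diagonal correction (`trace_mul_toCorr_deriv`). -/

theorem posSemidef_fromBlocks_diag {m n : Type} [Fintype m] [Fintype n]
    {A : Matrix m m ℝ} {B : Matrix n n ℝ} (hA : A.PosSemidef)
    (hB : B.PosSemidef) : (Matrix.fromBlocks A 0 0 B).PosSemidef := by
  refine .of_dotProduct_mulVec_nonneg ?_ fun x => ?_
  · rw [Matrix.isHermitian_fromBlocks_iff]
    exact ⟨hA.isHermitian, by simp, by simp, hB.isHermitian⟩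
  · rw [← Sum.elim_comp_inl_inr x, Matrix.fromBlocks_mulVec, star_trivial,
      sumElim_dotProduct_sumElim]
    have h1 := hA.dotProduct_mulVec_nonneg (x ∘ Sum.inl)
    have h2 := hB.dotProduct_mulVec_nonneg (x ∘ Sum.inr)
    simp only [star_trivial] at h1 h2
    simpa using add_nonneg h1 h2

/-! ### Matrix square roots and orthogonal diagonalisation. -/

section SquareRoot

variable {m n : Type} [Fintype m] [DecidableEq m] [Fintype n] [DecidableEq n]

theorem msqrt_posSemidef (A : Matrix n n ℝ) : (msqrt A).PosSemidef :=
  Matrix.nonneg_iff_posSemidef.mp (CFC.sqrt_nonneg A)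

theorem _root_.Matrix.PosSemidef.transpose_eq {k : Type} {A : Matrix k k ℝ} (hA : A.PosSemidef) :
    A.transpose = A := by
  simpa [Matrix.conjTranspose_eq_transpose_of_trivial] using hA.isHermitian.eq

theorem msqrt_transpose (A : Matrix n n ℝ) : (msqrt A).transpose = msqrt A :=
  (msqrt_posSemidef A).transpose_eq

theorem msqrt_mul_self {A : Matrix n n ℝ} (hA : A.PosSemidef) : msqrt A * msqrt A = A :=
  CFC.sqrt_mul_sqrt_self A (Matrix.nonneg_iff_posSemidef.mpr hA)

theorem msqrt_unique {A B : Matrix n n ℝ} (h : B * B = A) (hB : B.PosSemidef) : msqrt A = B :=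
  CFC.sqrt_unique h (Matrix.nonneg_iff_posSemidef.mpr hB)

theorem msqrt_posDef {A : Matrix n n ℝ} (hA : A.PosDef) : (msqrt A).PosDef := by
  rw [(msqrt_posSemidef A).posDef_iff_isUnit]
  have h := hA.isUnit
  rw [← msqrt_mul_self hA.posSemidef] at h
  exact isUnit_of_mul_isUnit_left h

theorem isUnit_det_msqrt {A : Matrix n n ℝ} (hA : A.PosDef) : IsUnit (msqrt A).det :=
  (Matrix.isUnit_iff_isUnit_det _).mp (msqrt_posDef hA).isUnit

open scoped Matrix.Norms.L2Operator in
theorem continuousOn_msqrt :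
    ContinuousOn (msqrt : Matrix n n ℝ → Matrix n n ℝ) {A | A.PosSemidef} := by
  have := CFC.continuousOn_sqrt (A := Matrix n n ℝ)
  simp only [Matrix.nonneg_iff_posSemidef] at this
  exact this

theorem tendsto_msqrt {ι : Type*} {F : Filter ι} {A : ι → Matrix n n ℝ} {B : Matrix n n ℝ}
    (h : Tendsto A F (𝓝 B)) (hA : ∀ᶠ t in F, (A t).PosSemidef) (hB : B.PosSemidef) :
    Tendsto (fun t => msqrt (A t)) F (𝓝 (msqrt B)) :=
  (continuousOn_msqrt B hB).tendsto.comp (tendsto_nhdsWithin_iff.mpr ⟨h, hA⟩)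

theorem msqrt_fromBlocks_diag {A : Matrix m m ℝ} {B : Matrix n n ℝ} (hA : A.PosSemidef)
    (hB : B.PosSemidef) :
    msqrt (Matrix.fromBlocks A 0 0 B) = Matrix.fromBlocks (msqrt A) 0 0 (msqrt B) := by
  refine msqrt_unique ?_ (posSemidef_fromBlocks_diag (msqrt_posSemidef A) (msqrt_posSemidef B))
  simp [Matrix.fromBlocks_multiply, msqrt_mul_self hA, msqrt_mul_self hB]

theorem exists_orthogonal_diagonalization {A : Matrix n n ℝ} (hA : A.IsHermitian) :
    ∃ Q ∈ Matrix.orthogonalGroup n ℝ, A = Q * Matrix.diagonal hA.eigenvalues * Q.transpose := by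
  refine ⟨hA.eigenvectorUnitary, hA.eigenvectorUnitary.2, ?_⟩
  conv_lhs => rw [hA.spectral_theorem, Unitary.conjStarAlgAut_apply]
  rfl

theorem posSemidef_conj_diagonal {k : Type} [Finite k] (Q : Matrix k n ℝ) {μ : n → ℝ} (hμ : ∀ i, 0 ≤ μ i) :
    (Q * Matrix.diagonal μ * Q.transpose).PosSemidef := by
  have := (Matrix.PosSemidef.diagonal (d := μ) hμ).mul_mul_conjTranspose_same Q
  rwa [Matrix.conjTranspose_eq_transpose_of_trivial] at this

theorem transpose_mul_self_of_orthogonal {Q : Matrix n n ℝ}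
    (hQ : Q ∈ Matrix.orthogonalGroup n ℝ) : Q.transpose * Q = 1 :=
  (Matrix.mem_orthogonalGroup_iff' n ℝ).mp hQ

theorem mul_transpose_self_of_orthogonal {Q : Matrix n n ℝ}
    (hQ : Q ∈ Matrix.orthogonalGroup n ℝ) : Q * Q.transpose = 1 :=
  (Matrix.mem_orthogonalGroup_iff n ℝ).mp hQ

theorem trace_orthogonal_conj {k : Type} [Fintype k] {Q : Matrix k n ℝ} (hQ : Q.transpose * Q = 1)
    (D : Matrix n n ℝ) : (Q * D * Q.transpose).trace = D.trace := by
  rw [Matrix.trace_mul_comm, ← Matrix.mul_assoc, hQ, Matrix.one_mul]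

theorem orthogonal_conj_mul {k : Type} [Fintype k] {Q : Matrix k n ℝ} (hQ : Q.transpose * Q = 1)
    (D E : Matrix n n ℝ) :
    Q * D * Q.transpose * (Q * E * Q.transpose) = Q * (D * E) * Q.transpose := by
  calc _ = Q * D * (Q.transpose * Q) * E * Q.transpose := by simp only [Matrix.mul_assoc]
    _ = _ := by rw [hQ]; simp only [Matrix.mul_assoc, Matrix.mul_one]

theorem msqrt_orthogonal_conj_diagonal {Q : Matrix m n ℝ} (hQ : Q.transpose * Q = 1)
    {μ : n → ℝ} (hμ : ∀ i, 0 ≤ μ i) :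
    msqrt (Q * Matrix.diagonal μ * Q.transpose) =
      Q * Matrix.diagonal (fun i => √(μ i)) * Q.transpose := by
  refine msqrt_unique ?_ (posSemidef_conj_diagonal Q fun i => Real.sqrt_nonneg _)
  rw [orthogonal_conj_mul hQ, Matrix.diagonal_mul_diagonal]
  simp [Real.mul_self_sqrt (hμ _)]

theorem trace_msqrt_eq_sum_sqrt {A : Matrix n n ℝ} (hA : A.PosSemidef) :
    (msqrt A).trace = ∑ i, √(hA.isHermitian.eigenvalues i) := by
  obtain ⟨Q, hQ, h⟩ := exists_orthogonal_diagonalization hA.isHermitian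
  conv_lhs => rw [h]
  rw [msqrt_orthogonal_conj_diagonal (transpose_mul_self_of_orthogonal hQ) hA.eigenvalues_nonneg,
    trace_orthogonal_conj (transpose_mul_self_of_orthogonal hQ),
    Matrix.trace_diagonal]

/-- Through the characteristic polynomial, the trace of the root becomes insensitive to the order of
a product, because `A * B` and `B * A` share that polynomial. -/
theorem trace_msqrt_eq_sum_roots {A : Matrix n n ℝ} (hA : A.PosSemidef) :
    (msqrt A).trace = (A.charpoly.roots.map Real.sqrt).sum := by
  rw [trace_msqrt_eq_sum_sqrt hA, hA.isHermitian.roots_charpoly_eq_eigenvalues, Multiset.map_map]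
  rfl

theorem trace_msqrt_mul_comm {A B : Matrix n n ℝ} (hAB : (A * B).PosSemidef)
    (hBA : (B * A).PosSemidef) : (msqrt (A * B)).trace = (msqrt (B * A)).trace := by
  rw [trace_msqrt_eq_sum_roots hAB, trace_msqrt_eq_sum_roots hBA, Matrix.charpoly_mul_comm]

end SquareRoot

/-! ### The fidelity: variational formula and one-sided derivative. -/

section Fidelity

variable {n : Type} [Fintype n] [DecidableEq n]

/-- The fidelity `tr ((A^{1/2} B A^{1/2})^{1/2})`. -/
noncomputable def fidelity (A B : Matrix n n ℝ) : ℝ :=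
  (msqrt (msqrt A * B * msqrt A)).trace

/-- The optimal transport map `A^{-1/2} (A^{1/2} B A^{1/2})^{1/2} A^{-1/2}` between centred
Gaussian laws with covariances `A` and `B`. -/
noncomputable def transportMap (A B : Matrix n n ℝ) : Matrix n n ℝ :=
  (msqrt A)⁻¹ * msqrt (msqrt A * B * msqrt A) * (msqrt A)⁻¹

theorem msqrt_conj_posSemidef (A : Matrix n n ℝ) {B : Matrix n n ℝ} (hB : B.PosSemidef) :
    (msqrt A * B * msqrt A).PosSemidef := by
  have := hB.mul_mul_conjTranspose_same (msqrt A)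
  rwa [Matrix.conjTranspose_eq_transpose_of_trivial, msqrt_transpose] at this

theorem posDef_symm_conj {C B : Matrix n n ℝ} (hC : C.transpose = C) (hC' : IsUnit C)
    (hB : B.PosDef) : (C * B * C).PosDef := by
  have := (Matrix.IsUnit.posDef_star_left_conjugate_iff (x := B) hC').mpr hB
  rwa [Matrix.star_eq_conjTranspose, Matrix.conjTranspose_eq_transpose_of_trivial, hC] at this

/-- The two conjugated matrices are the products, in opposite orders, of `msqrt A * msqrt B` and
`msqrt B * msqrt A`. -/
theorem fidelity_comm {A B : Matrix n n ℝ} (hA : A.PosSemidef) (hB : B.PosSemidef) :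
    fidelity A B = fidelity B A := by
  have h1 : msqrt A * B * msqrt A = (msqrt A * msqrt B) * (msqrt B * msqrt A) := by
    conv_lhs => rw [← msqrt_mul_self hB]
    simp only [Matrix.mul_assoc]
  have h2 : msqrt B * A * msqrt B = (msqrt B * msqrt A) * (msqrt A * msqrt B) := by
    conv_lhs => rw [← msqrt_mul_self hA]
    simp only [Matrix.mul_assoc]
  rw [fidelity, fidelity, h1, h2]
  exact trace_msqrt_mul_comm (h1 ▸ msqrt_conj_posSemidef A hB) (h2 ▸ msqrt_conj_posSemidef B hA)

/-- A matrix form of the arithmetic-geometric mean inequality: with `B = M^{1/2}`, expand the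
nonnegative trace of `(B - C) C⁻¹ (B - C)`. -/
theorem trace_msqrt_le {M C : Matrix n n ℝ} (hM : M.PosSemidef) (hC : C.PosDef) :
    (msqrt M).trace ≤ (C.trace + (C⁻¹ * M).trace) / 2 := by
  have hCu : IsUnit C.det := (Matrix.isUnit_iff_isUnit_det _).mp hC.isUnit
  set B := msqrt M with hB
  have hE : (B - C).transpose = B - C := by
    rw [Matrix.transpose_sub, msqrt_transpose, hC.posSemidef.transpose_eq]
  have h0 := (hC.inv.posSemidef.mul_mul_conjTranspose_same (B - C)).trace_nonneg
  rw [Matrix.conjTranspose_eq_transpose_of_trivial, hE] at h0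
  have h1 : (B - C) * C⁻¹ * (B - C) = B * C⁻¹ * B - B - B + C := by
    rw [Matrix.sub_mul, Matrix.mul_nonsing_inv _ hCu, Matrix.sub_mul, Matrix.mul_sub,
      Matrix.mul_assoc B C⁻¹ C, Matrix.nonsing_inv_mul _ hCu]
    simp only [Matrix.mul_one, Matrix.one_mul]
    abel
  have h2 : (B * C⁻¹ * B).trace = (C⁻¹ * M).trace := by
    rw [Matrix.mul_assoc, Matrix.trace_mul_comm, Matrix.mul_assoc, hB, msqrt_mul_self hM]
  rw [h1, Matrix.trace_add, Matrix.trace_sub, Matrix.trace_sub, h2] at h0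
  linarith

/-- This is `trace_msqrt_le` with `C = A^{1/2} X A^{1/2}`, after cyclic permutation under the trace.
-/
theorem fidelity_le {A B X : Matrix n n ℝ} (hA : A.PosDef) (hB : B.PosSemidef) (hX : X.PosDef) :
    fidelity A B ≤ ((X * A).trace + (X⁻¹ * B).trace) / 2 := by
  have hu := isUnit_det_msqrt hA
  have hC := posDef_symm_conj (msqrt_transpose A) (msqrt_posDef hA).isUnit hX
  refine (trace_msqrt_le (msqrt_conj_posSemidef A hB) hC).trans_eq ?_
  congr 2
  · rw [Matrix.mul_assoc, Matrix.trace_mul_comm, Matrix.mul_assoc, msqrt_mul_self hA.posSemidef]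
  · rw [Matrix.mul_inv_rev, Matrix.mul_inv_rev]
    calc _ = ((msqrt A)⁻¹ * (X⁻¹ * ((msqrt A)⁻¹ * msqrt A) * B * msqrt A)).trace := by
          simp only [Matrix.mul_assoc]
      _ = _ := by
          rw [Matrix.trace_mul_comm, Matrix.nonsing_inv_mul _ hu, Matrix.mul_one, Matrix.mul_assoc,
            Matrix.mul_nonsing_inv _ hu, Matrix.mul_one]

theorem transportMap_posDef {A B : Matrix n n ℝ} (hA : A.PosDef) (hB : B.PosDef) :
    (transportMap A B).PosDef := by
  have hi : ((msqrt A)⁻¹).transpose = (msqrt A)⁻¹ := by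
    rw [Matrix.transpose_nonsing_inv, msqrt_transpose]
  exact posDef_symm_conj hi (msqrt_posDef hA).inv.isUnit
    (msqrt_posDef (posDef_symm_conj (msqrt_transpose A) (msqrt_posDef hA).isUnit hB))

theorem fidelity_eq_trace_transportMap_mul {A B : Matrix n n ℝ} (hA : A.PosDef) :
    (transportMap A B * A).trace = fidelity A B := by
  have hu := isUnit_det_msqrt hA
  have h : (msqrt A)⁻¹ * A = msqrt A := by
    nth_rewrite 2 [← msqrt_mul_self hA.posSemidef]
    rw [← Matrix.mul_assoc, Matrix.nonsing_inv_mul _ hu, Matrix.one_mul]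
  rw [transportMap, fidelity, Matrix.mul_assoc, h, Matrix.mul_assoc, Matrix.trace_mul_comm,
    Matrix.mul_assoc, Matrix.mul_nonsing_inv _ hu, Matrix.mul_one]

theorem fidelity_eq_trace_transportMap_inv_mul {A B : Matrix n n ℝ} (hA : A.PosDef)
    (hB : B.PosDef) : ((transportMap A B)⁻¹ * B).trace = fidelity A B := by
  have hM := posDef_symm_conj (msqrt_transpose A) (msqrt_posDef hA).isUnit hB
  have hu := isUnit_det_msqrt hM
  rw [transportMap, Matrix.mul_inv_rev, Matrix.mul_inv_rev,
    Matrix.nonsing_inv_nonsing_inv _ (isUnit_det_msqrt hA), fidelity]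
  have h : (msqrt (msqrt A * B * msqrt A))⁻¹ * (msqrt A * B * msqrt A) =
      msqrt (msqrt A * B * msqrt A) := by
    nth_rewrite 2 [← msqrt_mul_self hM.posSemidef]
    rw [← Matrix.mul_assoc, Matrix.nonsing_inv_mul _ hu, Matrix.one_mul]
  conv_rhs => rw [← h]
  rw [Matrix.mul_assoc, Matrix.trace_mul_comm]
  simp only [Matrix.mul_assoc]

/-- The transport map attains equality in `fidelity_le`; each of the two traces alone already equals
the fidelity. -/
theorem fidelity_eq {A B : Matrix n n ℝ} (hA : A.PosDef) (hB : B.PosDef) :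
    fidelity A B = ((transportMap A B * A).trace + ((transportMap A B)⁻¹ * B).trace) / 2 := by
  rw [fidelity_eq_trace_transportMap_mul hA, fidelity_eq_trace_transportMap_inv_mul hA hB]
  ring

theorem tendsto_matrix_inv {ι : Type*} {F : Filter ι} {A : ι → Matrix n n ℝ} {B : Matrix n n ℝ}
    (h : Tendsto A F (𝓝 B)) (hB : IsUnit B.det) :
    Tendsto (fun t => (A t)⁻¹) F (𝓝 B⁻¹) := by
  simp only [Matrix.inv_def, Ring.inverse_eq_inv']
  refine Tendsto.smul (((continuous_id.matrix_det.tendsto B).comp h).inv₀ hB.ne_zero) ?_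
  exact (continuous_id.matrix_adjugate.tendsto B).comp h

theorem tendsto_transportMap {ι : Type*} {F : Filter ι} {A B : ι → Matrix n n ℝ}
    {A₀ B₀ : Matrix n n ℝ} (hA : Tendsto A F (𝓝 A₀)) (hB : Tendsto B F (𝓝 B₀))
    (hAp : ∀ᶠ t in F, (A t).PosDef) (hBp : ∀ᶠ t in F, (B t).PosDef)
    (hA₀ : A₀.PosDef) (hB₀ : B₀.PosDef) :
    Tendsto (fun t => transportMap (A t) (B t)) F (𝓝 (transportMap A₀ B₀)) := by
  have h1 := tendsto_msqrt hA (hAp.mono fun _ h => h.posSemidef) hA₀.posSemidef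
  have h2 := tendsto_matrix_inv h1 (isUnit_det_msqrt hA₀)
  have h3 : Tendsto (fun t => msqrt (A t) * B t * msqrt (A t)) F
      (𝓝 (msqrt A₀ * B₀ * msqrt A₀)) := (h1.mul hB).mul h1
  have h4 := tendsto_msqrt h3 (hBp.mono fun _ h => msqrt_conj_posSemidef _ h.posSemidef)
    (msqrt_conj_posSemidef _ hB₀.posSemidef)
  exact (h2.mul h4).mul h2

/-- One-sided derivative of the fidelity along a path of pairs of positive definite matrices. -/
theorem tendsto_slope_fidelity {A B : ℝ → Matrix n n ℝ} {A' B' : Matrix n n ℝ}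
    (hA : Tendsto (fun t => t⁻¹ • (A t - A 0)) (𝓝[>] 0) (𝓝 A'))
    (hB : Tendsto (fun t => t⁻¹ • (B t - B 0)) (𝓝[>] 0) (𝓝 B'))
    (hAc : Tendsto A (𝓝[>] 0) (𝓝 (A 0))) (hBc : Tendsto B (𝓝[>] 0) (𝓝 (B 0)))
    (hAp : ∀ᶠ t in 𝓝[>] 0, (A t).PosDef) (hBp : ∀ᶠ t in 𝓝[>] 0, (B t).PosDef)
    (hA₀ : (A 0).PosDef) (hB₀ : (B 0).PosDef) :
    Tendsto (fun t => t⁻¹ * (fidelity (A t) (B t) - fidelity (A 0) (B 0))) (𝓝[>] 0)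
      (𝓝 (((transportMap (A 0) (B 0) * A').trace +
        ((transportMap (A 0) (B 0))⁻¹ * B').trace) / 2)) := by
  set J₀ := transportMap (A 0) (B 0) with hJ₀
  have hJ₀p : J₀.PosDef := transportMap_posDef hA₀ hB₀
  have hJ := tendsto_transportMap hAc hBc hAp hBp hA₀ hB₀
  have hJi := tendsto_matrix_inv hJ ((Matrix.isUnit_iff_isUnit_det _).mp hJ₀p.isUnit)
  have trlim : ∀ {f : ℝ → Matrix n n ℝ} {M : Matrix n n ℝ}, Tendsto f (𝓝[>] 0) (𝓝 M) →
      Tendsto (fun t => (f t).trace) (𝓝[>] 0) (𝓝 M.trace) := fun h =>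
    ((continuous_id.matrix_trace.tendsto _).comp h)
  -- Envelope argument. Testing the variational bound at time 0 with the minimiser of time `t`
  -- bounds the increment below; testing it at time `t` with the minimiser of time 0 bounds it
  -- above. Both bounds have the same limit because the transport map is continuous.
  have hlow : Tendsto (fun t => ((transportMap (A t) (B t) * (t⁻¹ • (A t - A 0))).trace +
      ((transportMap (A t) (B t))⁻¹ * (t⁻¹ • (B t - B 0))).trace) / 2) (𝓝[>] 0)
      (𝓝 (((J₀ * A').trace + (J₀⁻¹ * B').trace) / 2)) :=
    ((trlim (hJ.mul hA)).add (trlim (hJi.mul hB))).div_const 2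
  have hupp : Tendsto (fun t => ((J₀ * (t⁻¹ • (A t - A 0))).trace +
      (J₀⁻¹ * (t⁻¹ • (B t - B 0))).trace) / 2) (𝓝[>] 0)
      (𝓝 (((J₀ * A').trace + (J₀⁻¹ * B').trace) / 2)) :=
    ((trlim (tendsto_const_nhds.mul hA)).add (trlim (tendsto_const_nhds.mul hB))).div_const 2
  refine tendsto_of_tendsto_of_tendsto_of_le_of_le' hlow hupp ?_ ?_
  · filter_upwards [hAp, hBp, self_mem_nhdsWithin] with t hAt hBt ht
    have h1 := fidelity_le hA₀ hB₀.posSemidef (transportMap_posDef hAt hBt)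
    have h2 := fidelity_eq hAt hBt
    simp only [Matrix.mul_smul, Matrix.trace_smul, smul_eq_mul, Matrix.mul_sub, Matrix.trace_sub]
    rw [← mul_add, mul_div_assoc]
    refine mul_le_mul_of_nonneg_left ?_ (inv_nonneg.mpr (le_of_lt ht))
    linarith
  · filter_upwards [hAp, hBp, self_mem_nhdsWithin] with t hAt hBt ht
    have h1 := fidelity_le hAt hBt.posSemidef hJ₀p
    have h2 := fidelity_eq hA₀ hB₀
    simp only [Matrix.mul_smul, Matrix.trace_smul, smul_eq_mul, Matrix.mul_sub, Matrix.trace_sub]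
    rw [← mul_add, mul_div_assoc]
    refine mul_le_mul_of_nonneg_left ?_ (inv_nonneg.mpr (le_of_lt ht))
    linarith

end Fidelity

/-! ### Rearrangement inequalities from doubly stochastic matrices. -/

section Rearrangement

/-- By Birkhoff's theorem `P` is a convex combination of permutation matrices, and for each
permutation this is the rearrangement inequality for oppositely ordered sequences. -/
theorem sum_mul_le_sum_doublyStochastic {n : Type*} [Fintype n] [DecidableEq n]
    {P : Matrix n n ℝ} (hP : P ∈ doublyStochastic ℝ n) {x w : n → ℝ} (h : Antivary x w) :
    ∑ i, x i * w i ≤ ∑ i, ∑ j, x i * w j * P i j := by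
  obtain ⟨c, hc, hc1, rfl⟩ := exists_eq_sum_perm_of_mem_doublyStochastic hP
  have key : ∑ i, ∑ j, x i * w j * (∑ σ, c σ • Equiv.Perm.permMatrix ℝ σ) i j =
      ∑ σ, c σ * ∑ i, x i * w (σ i) := by
    simp only [Matrix.sum_apply, Matrix.smul_apply, smul_eq_mul, Finset.mul_sum]
    rw [Finset.sum_comm' (t' := Finset.univ) (s' := fun _ => Finset.univ) (by simp)]
    rw [Finset.sum_comm]
    simp_rw [Finset.sum_comm (s := (Finset.univ : Finset n)) (t := (Finset.univ : Finset (Equiv.Perm n)))]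
    refine Finset.sum_congr rfl fun σ _ => Finset.sum_congr rfl fun i _ => ?_
    rw [Finset.sum_eq_single (σ i)]
    · simp [Equiv.Perm.permMatrix, PEquiv.toMatrix_apply]; ring
    · intro j _ hj
      simp [Equiv.Perm.permMatrix, PEquiv.toMatrix_apply, hj.symm]
    · simp
  rw [key]
  calc ∑ i, x i * w i = ∑ σ, c σ * ∑ i, x i * w i := by rw [← Finset.sum_mul, hc1, one_mul]
    _ ≤ _ := Finset.sum_le_sum fun σ _ =>
      mul_le_mul_of_nonneg_left h.sum_mul_le_sum_mul_comp_perm (hc σ)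

theorem doublyStochastic_sq_of_orthogonal {n : Type} [Fintype n] [DecidableEq n]
    {Q : Matrix n n ℝ} (hQ : Q ∈ Matrix.orthogonalGroup n ℝ) :
    (Matrix.of fun i j => Q i j ^ 2) ∈ doublyStochastic ℝ n := by
  rw [mem_doublyStochastic_iff_sum]
  refine ⟨fun i j => sq_nonneg _, fun i => ?_, fun j => ?_⟩
  · have := congrFun (congrFun (mul_transpose_self_of_orthogonal hQ) i) i
    simpa [Matrix.mul_apply, sq] using this
  · have := congrFun (congrFun (transpose_mul_self_of_orthogonal hQ) j) j
    simpa [Matrix.mul_apply, sq] using this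

theorem pad_antitone {n : ℕ} {l : Fin n → ℝ} (hl : Antitone l) (h0 : ∀ i, 0 ≤ l i) :
    Antitone (pad l) := by
  intro i j hij
  unfold pad
  split_ifs with h1 h2 h2
  · exact hl hij
  · omega
  · exact h0 _
  · exact le_rfl

theorem pad_nonneg {n : ℕ} {l : Fin n → ℝ} (h0 : ∀ i, 0 ≤ l i) (j : ℕ) : 0 ≤ pad l j := by
  unfold pad
  split_ifs
  · exact h0 _
  · exact le_rfl

/-- Rearrangement for the squared entries of a matrix with `p` orthonormal rows of length
`p + q`. -/
theorem sum_pad_mul_le_sum_rowStochastic {p q : ℕ} (hq : 0 < q) {l : Fin p → ℝ} (hl : Antitone l)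
    (h0 : ∀ i, 0 ≤ l i) {w : Fin (p + q) → ℝ} (hw : Monotone w)
    {P : Fin p → Fin (p + q) → ℝ} (hP : ∀ a i, 0 ≤ P a i) (hrow : ∀ a, ∑ i, P a i = 1)
    (hcol : ∀ i, ∑ a, P a i ≤ 1) :
    ∑ i : Fin (p + q), pad l i * w i ≤ ∑ a, ∑ i, l a * w i * P a i := by
  have hq' : (q : ℝ) ≠ 0 := by positivity
  -- Completion to a doubly stochastic matrix: the missing mass of each column is shared equally
  -- among `q` extra rows, whose weight in `pad l` is zero. This needs `q ≠ 0`.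
  let P' : Matrix (Fin (p + q)) (Fin (p + q)) ℝ :=
    Matrix.of (Fin.addCases P fun _ i => (1 - ∑ a, P a i) / q)
  have hleft : ∀ a i, P' (Fin.castAdd q a) i = P a i := fun a i => by simp [P']
  have hright : ∀ b i, P' (Fin.natAdd p b) i = (1 - ∑ a, P a i) / q := fun b i => by simp [P']
  have hmem : P' ∈ doublyStochastic ℝ (Fin (p + q)) := by
    rw [mem_doublyStochastic_iff_sum]
    refine ⟨fun i j => ?_, fun i => ?_, fun j => ?_⟩
    · refine Fin.addCases (fun a => ?_) (fun b => ?_) i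
      · rw [hleft]; exact hP _ _
      · rw [hright]; exact div_nonneg (sub_nonneg.mpr (hcol j)) (Nat.cast_nonneg q)
    · refine Fin.addCases (fun a => ?_) (fun b => ?_) i
      · simp only [hleft, hrow]
      · simp only [hright]
        rw [← Finset.sum_div, Finset.sum_sub_distrib, Finset.sum_comm]
        simp [hrow, hq']
    · rw [Fin.sum_univ_add]
      simp only [hleft, hright, Finset.sum_const, Finset.card_univ, Fintype.card_fin,
        nsmul_eq_mul, mul_div_cancel₀ _ hq', add_sub_cancel]
  have hanti : Antivary (fun i : Fin (p + q) => pad l i) w := by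
    intro i j hij
    exact pad_antitone hl h0 (le_of_lt (hw.reflect_lt hij))
  refine (sum_mul_le_sum_doublyStochastic hmem hanti).trans_eq ?_
  rw [Fin.sum_univ_add]
  simp [hleft, pad]

/-- If the rows of `N` are orthonormal then its columns have norm at most one. -/
theorem sum_sq_col_le_one {p d : ℕ} {N : Matrix (Fin p) (Fin d) ℝ} (hN : N * N.transpose = 1)
    (i : Fin d) : ∑ a, N a i ^ 2 ≤ 1 := by
  set G := N.transpose * N with hG
  -- The Gram matrix `G` is the orthogonal projection onto the row space of `N`, so `G i i` is the
  -- squared norm of its own row and hence at least `G i i ^ 2`.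
  have h1 : G * G.transpose = G := by
    rw [hG, Matrix.transpose_mul, Matrix.transpose_transpose]
    calc _ = N.transpose * (N * N.transpose) * N := by simp only [Matrix.mul_assoc]
      _ = _ := by rw [hN, Matrix.mul_one]
  have h2 : G i i = ∑ a, N a i ^ 2 := by simp [hG, Matrix.mul_apply, sq]
  have h3 : G i i = ∑ j, G i j ^ 2 := by
    conv_lhs => rw [← h1]
    simp [Matrix.mul_apply, sq]
  have h4 : G i i ^ 2 ≤ G i i := by
    conv_rhs => rw [h3]
    exact Finset.single_le_sum (f := fun j => G i j ^ 2) (fun j _ => sq_nonneg _)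
      (Finset.mem_univ i)
  rw [← h2]
  nlinarith [sq_nonneg (G i i - 1)]

/-- Lower bound for a weighted sum over a frame of a positive definite matrix, in terms of its
ordered eigenvalues. -/
theorem sum_pad_mul_le_of_frame {p d : ℕ} (hpd : p < d) {A U : Matrix (Fin p) (Fin p) ℝ}
    {l : Fin p → ℝ} (hA : IsOrderedEigendecomp A U l) (hl : ∀ a, 0 < l a)
    {Q : Matrix (Fin p) (Fin d) ℝ} {μ w : Fin d → ℝ} (hμ : ∀ i, 0 ≤ μ i) (hw : Monotone w)
    (hQ : Q * Matrix.diagonal μ * Q.transpose = A) :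
    ∑ i : Fin d, pad l i * w i ≤ ∑ i, w i * (μ i * ∑ a, Q a i ^ 2) := by
  have hU := transpose_mul_self_of_orthogonal hA.orthogonal
  have hU' := mul_transpose_self_of_orthogonal hA.orthogonal
  set V := U.transpose * Q with hV
  -- Whitening: in the eigenbasis of `A`, rescaling by `l^{-1/2}` makes the rows orthonormal, while
  -- `l a * N a i ^ 2` still records the weight `μ i * V a i ^ 2`.
  set N : Matrix (Fin p) (Fin d) ℝ :=
    Matrix.diagonal (fun a => (√(l a))⁻¹) * V * Matrix.diagonal (fun i => √(μ i)) with hN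
  have hNe : ∀ a i, l a * N a i ^ 2 = μ i * V a i ^ 2 := by
    intro a i
    have : N a i = (√(l a))⁻¹ * V a i * √(μ i) := by
      rw [hN, Matrix.mul_diagonal, Matrix.diagonal_mul]
    rw [this, mul_pow, mul_pow, inv_pow, Real.sq_sqrt (hl a).le, Real.sq_sqrt (hμ i)]
    field_simp [(hl a).ne']
  have hNN : N * N.transpose = 1 := by
    have h1 : V * Matrix.diagonal μ * V.transpose = Matrix.diagonal l := by
      rw [hV, Matrix.transpose_mul, Matrix.transpose_transpose]
      calc _ = U.transpose * (Q * Matrix.diagonal μ * Q.transpose) * U := by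
            simp only [Matrix.mul_assoc]
        _ = (U.transpose * U) * Matrix.diagonal l * (U.transpose * U) := by
            rw [hQ, hA.eq]; simp only [Matrix.mul_assoc]
        _ = _ := by rw [hU, Matrix.one_mul, Matrix.mul_one]
    have h2 : Matrix.diagonal (fun i => √(μ i)) * Matrix.diagonal (fun i => √(μ i)) =
        Matrix.diagonal μ := by
      rw [Matrix.diagonal_mul_diagonal]
      simp [Real.mul_self_sqrt (hμ _)]
    rw [hN, Matrix.transpose_mul, Matrix.transpose_mul, Matrix.diagonal_transpose,
      Matrix.diagonal_transpose]
    calc _ = Matrix.diagonal (fun a => (√(l a))⁻¹) * (V * (Matrix.diagonal (fun i => √(μ i)) *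
          Matrix.diagonal (fun i => √(μ i))) * V.transpose) *
          Matrix.diagonal (fun a => (√(l a))⁻¹) := by simp only [Matrix.mul_assoc]
      _ = 1 := by
        rw [h2, h1, Matrix.diagonal_mul_diagonal, Matrix.diagonal_mul_diagonal,
          ← Matrix.diagonal_one]
        congr 1
        funext a
        have h3 : √(l a) ≠ 0 := (Real.sqrt_pos.mpr (hl a)).ne'
        nth_rewrite 2 [← Real.mul_self_sqrt (hl a).le]
        field_simp
  have hVQ : ∀ i, ∑ a, V a i ^ 2 = ∑ a, Q a i ^ 2 := by
    intro i
    have : V.transpose * V = Q.transpose * Q := by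
      rw [hV, Matrix.transpose_mul, Matrix.transpose_transpose]
      calc _ = Q.transpose * (U * U.transpose) * Q := by simp only [Matrix.mul_assoc]
        _ = _ := by rw [hU', Matrix.mul_one]
    simpa [Matrix.mul_apply, sq] using congrFun (congrFun this i) i
  obtain ⟨q, rfl⟩ := Nat.exists_eq_add_of_le hpd.le
  have := sum_pad_mul_le_sum_rowStochastic (q := q) (by omega) hA.antitone
    (fun a => (hl a).le) hw (P := fun a i => N a i ^ 2) (fun _ _ => sq_nonneg _)
    (fun a => by simpa [Matrix.mul_apply, sq] using congrFun (congrFun hNN a) a)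
    (sum_sq_col_le_one hNN)
  refine this.trans_eq ?_
  rw [Finset.sum_comm]
  refine Finset.sum_congr rfl fun i _ => ?_
  rw [← hVQ, Finset.mul_sum, Finset.mul_sum]
  refine Finset.sum_congr rfl fun a _ => ?_
  rw [← hNe]
  ring

end Rearrangement

/-! ### Ordered eigenvalues: continuity and derivatives at simple spectra. -/

section Eigenvalues

theorem exists_orderedEigendecomp {n : ℕ} {A : Matrix (Fin n) (Fin n) ℝ} (hA : A.IsHermitian) :
    ∃ U l, IsOrderedEigendecomp A U l := by
  obtain ⟨Q, hQ, h⟩ := exists_orthogonal_diagonalization hA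
  set μ := hA.eigenvalues
  let σ : Equiv.Perm (Fin n) := Tuple.sort (-μ)
  have hσ : Antitone (μ ∘ σ) := by
    have := Tuple.monotone_sort (-μ)
    intro i j hij
    simpa using this hij
  have hQ' : (Q.submatrix id σ).transpose * Q.submatrix id σ = 1 := by
    rw [Matrix.transpose_submatrix]
    have := Matrix.submatrix_mul_equiv Q.transpose Q σ (Equiv.refl _) σ
    rw [Equiv.coe_refl] at this
    rw [this, transpose_mul_self_of_orthogonal hQ]
    simp
  refine ⟨Q.submatrix id σ, μ ∘ σ, (Matrix.mem_orthogonalGroup_iff' _ ℝ).mpr hQ', hσ, ?_⟩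
  have h1 := Matrix.submatrix_diagonal_equiv μ σ
  have h2 := Matrix.submatrix_mul_equiv Q (Matrix.diagonal μ) id σ σ
  have h3 := Matrix.submatrix_mul_equiv (Q * Matrix.diagonal μ) Q.transpose id σ id
  rw [← h1, h2, Matrix.transpose_submatrix, h3, ← h, Matrix.submatrix_id_id]

/-- The squared entries of the orthogonal matrix `Uᵀ V` are doubly stochastic weights, which puts
the trace in the form treated by the rearrangement inequality. -/
theorem trace_mul_orderedEigendecomp {n : ℕ} {A B U V : Matrix (Fin n) (Fin n) ℝ}
    {l m : Fin n → ℝ} (hA : IsOrderedEigendecomp A U l) (hB : IsOrderedEigendecomp B V m) :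
    (A * B).trace = ∑ i, ∑ j, l i * m j * (U.transpose * V) i j ^ 2 := by
  set O := U.transpose * V with hO
  have h1 : (A * B).trace =
      (Matrix.diagonal l * O * (Matrix.diagonal m * O.transpose)).trace := by
    rw [hA.eq, hB.eq, hO, Matrix.transpose_mul, Matrix.transpose_transpose,
      Matrix.mul_assoc (U * _), Matrix.mul_assoc U, Matrix.trace_mul_comm U]
    simp only [Matrix.mul_assoc]
  rw [h1, Matrix.trace]
  refine Finset.sum_congr rfl fun i _ => ?_
  rw [Matrix.diag_apply, Matrix.mul_apply]
  refine Finset.sum_congr rfl fun j _ => ?_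
  rw [Matrix.diagonal_mul, Matrix.diagonal_mul, Matrix.transpose_apply]
  ring

theorem IsOrderedEigendecomp.transpose_eq {n : ℕ} {A U : Matrix (Fin n) (Fin n) ℝ}
    {l : Fin n → ℝ} (hA : IsOrderedEigendecomp A U l) : A.transpose = A := by
  rw [hA.eq]
  simp [Matrix.transpose_mul, Matrix.mul_assoc]

theorem IsOrderedEigendecomp.trace_mul_self {n : ℕ} {A U : Matrix (Fin n) (Fin n) ℝ}
    {l : Fin n → ℝ} (hA : IsOrderedEigendecomp A U l) : (A * A).trace = ∑ i, l i ^ 2 := by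
  rw [trace_mul_orderedEigendecomp hA hA, transpose_mul_self_of_orthogonal hA.orthogonal]
  refine Finset.sum_congr rfl fun i _ => ?_
  rw [Finset.sum_eq_single i] <;> simp +contextual [sq, eq_comm]

/-- The Hoffman--Wielandt inequality for ordered eigenvalues. -/
theorem sum_sq_eigenvalues_sub_le {n : ℕ} {A B U V : Matrix (Fin n) (Fin n) ℝ} {l m : Fin n → ℝ}
    (hA : IsOrderedEigendecomp A U l) (hB : IsOrderedEigendecomp B V m) :
    ∑ i, (l i - m i) ^ 2 ≤ ∑ i, ∑ j, (A i j - B i j) ^ 2 := by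
  have hO : U.transpose * V ∈ Matrix.orthogonalGroup (Fin n) ℝ :=
    mul_mem ((Matrix.mem_orthogonalGroup_iff _ ℝ).mpr
      (by simpa using transpose_mul_self_of_orthogonal hA.orthogonal)) hB.orthogonal
  -- Negating `m` makes the two sequences oppositely ordered, so the lower bound becomes an upper
  -- bound for `tr (A * B)`.
  have h1 := sum_mul_le_sum_doublyStochastic (doublyStochastic_sq_of_orthogonal hO)
    (x := l) (w := -m) (fun i j hij => hA.antitone
      (le_of_lt (hB.antitone.reflect_lt (neg_lt_neg_iff.mp hij))))
  have h2 := trace_mul_orderedEigendecomp hA hB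
  have h3 : ∑ i, ∑ j, (A i j - B i j) ^ 2 =
      (A * A).trace - 2 * (A * B).trace + (B * B).trace := by
    have : ∑ i, ∑ j, (A i j - B i j) ^ 2 = ((A - B) * (A - B).transpose).trace := by
      simp [Matrix.trace, Matrix.mul_apply, sq]
    rw [this, Matrix.transpose_sub, hA.transpose_eq, hB.transpose_eq, Matrix.sub_mul,
      Matrix.mul_sub, Matrix.mul_sub, Matrix.trace_sub, Matrix.trace_sub, Matrix.trace_sub,
      Matrix.trace_mul_comm B A]
    ring
  rw [h3, hA.trace_mul_self, hB.trace_mul_self, h2]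
  simp only [Pi.neg_apply, Matrix.of_apply, mul_neg, neg_mul, Finset.sum_neg_distrib] at h1
  have h4 : ∑ i, (l i - m i) ^ 2 = ∑ i, l i ^ 2 - 2 * ∑ i, l i * m i + ∑ i, m i ^ 2 := by
    rw [Finset.mul_sum, ← Finset.sum_sub_distrib, ← Finset.sum_add_distrib]
    exact Finset.sum_congr rfl fun i _ => by ring
  rw [h4]
  linarith

/-- Hoffman-Wielandt bounds each eigenvalue increment by the entrywise distance, so nothing is asked
of the eigenvectors `U t`, which may jump. -/
theorem tendsto_eigenvalue {ι : Type*} {F : Filter ι} {n : ℕ}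
    {A U : ι → Matrix (Fin n) (Fin n) ℝ} {l : ι → Fin n → ℝ}
    {A₀ U₀ : Matrix (Fin n) (Fin n) ℝ} {l₀ : Fin n → ℝ}
    (hA : ∀ᶠ t in F, IsOrderedEigendecomp (A t) (U t) (l t))
    (hA₀ : IsOrderedEigendecomp A₀ U₀ l₀) (h : Tendsto A F (𝓝 A₀)) (j : Fin n) :
    Tendsto (fun t => l t j) F (𝓝 (l₀ j)) := by
  have h1 : Tendsto (fun t => ∑ i, ∑ j, (A t i j - A₀ i j) ^ 2) F (𝓝 0) := by
    have : Tendsto (fun t => ∑ i, ∑ j, (A t i j - A₀ i j) ^ 2) F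
        (𝓝 (∑ i, ∑ j, (A₀ i j - A₀ i j) ^ 2)) :=
      tendsto_finsetSum _ fun i _ => tendsto_finsetSum _ fun j _ =>
        (((tendsto_pi_nhds.mp (tendsto_pi_nhds.mp h i) j)).sub_const _).pow 2
    simpa using this
  have h2 : Tendsto (fun t => (l t j - l₀ j) ^ 2) F (𝓝 0) := by
    refine squeeze_zero' (.of_forall fun _ => sq_nonneg _) ?_ h1
    filter_upwards [hA] with t ht
    exact (Finset.single_le_sum (f := fun j => (l t j - l₀ j) ^ 2) (fun _ _ => sq_nonneg _)
      (Finset.mem_univ j)).trans (sum_sq_eigenvalues_sub_le ht hA₀)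
  have h3 : Tendsto (fun t => l t j - l₀ j) F (𝓝 0) := by
    rw [tendsto_zero_iff_abs_tendsto_zero]
    have := h2.sqrt
    simpa [Function.comp_def, Real.sqrt_sq_eq_abs] using this
  simpa using h3.add_const (l₀ j)

/-- One-sided derivative of a simple eigenvalue. -/
theorem tendsto_slope_eigenvalue {n : ℕ} {A U : ℝ → Matrix (Fin n) (Fin n) ℝ}
    {l : ℝ → Fin n → ℝ} {A' U₀ : Matrix (Fin n) (Fin n) ℝ} {l₀ : Fin n → ℝ}
    (hA : ∀ᶠ t in 𝓝[>] 0, IsOrderedEigendecomp (A t) (U t) (l t))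
    (hA₀ : IsOrderedEigendecomp (A 0) U₀ l₀) (hinj : Function.Injective l₀)
    (hc : Tendsto A (𝓝[>] 0) (𝓝 (A 0)))
    (hs : Tendsto (fun t => t⁻¹ • (A t - A 0)) (𝓝[>] 0) (𝓝 A')) (j : Fin n) :
    Tendsto (fun t => t⁻¹ * (l t j - l₀ j)) (𝓝[>] 0) (𝓝 ((U₀.transpose * A' * U₀) j j)) := by
  -- `C t` holds the moving eigenvectors in the fixed basis `U₀`. In these coordinates the
  -- eigenvalue equation reads `E C = C Λ_t - Λ_0 C`.
  set C : ℝ → Matrix (Fin n) (Fin n) ℝ := fun t => U₀.transpose * U t with hC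
  set E : ℝ → Matrix (Fin n) (Fin n) ℝ := fun t => U₀.transpose * (A t - A 0) * U₀ with hE
  have hl := fun j => tendsto_eigenvalue hA hA₀ hc j
  have ent : ∀ {f : ℝ → Matrix (Fin n) (Fin n) ℝ} {M : Matrix (Fin n) (Fin n) ℝ},
      Tendsto f (𝓝[>] 0) (𝓝 M) → ∀ i j, Tendsto (fun t => f t i j) (𝓝[>] 0) (𝓝 (M i j)) :=
    fun h i j => tendsto_pi_nhds.mp (tendsto_pi_nhds.mp h i) j
  have hcol : ∀ᶠ t in 𝓝[>] 0, ∑ i, C t i j ^ 2 = 1 := by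
    filter_upwards [hA] with t ht
    have : (C t).transpose * C t = 1 := by
      rw [hC, Matrix.transpose_mul, Matrix.transpose_transpose]
      calc _ = (U t).transpose * (U₀ * U₀.transpose) * U t := by simp only [Matrix.mul_assoc]
        _ = 1 := by
          rw [mul_transpose_self_of_orthogonal hA₀.orthogonal, Matrix.mul_one,
            transpose_mul_self_of_orthogonal ht.orthogonal]
    simpa [Matrix.mul_apply, sq] using congrFun (congrFun this j) j
  have hbd : ∀ᶠ t in 𝓝[>] 0, ∀ i, |C t i j| ≤ 1 := by
    filter_upwards [hcol] with t ht i
    rw [← sq_le_one_iff_abs_le_one, ← ht]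
    exact Finset.single_le_sum (f := fun i => C t i j ^ 2) (fun _ _ => sq_nonneg _)
      (Finset.mem_univ i)
  have hrel : ∀ᶠ t in 𝓝[>] 0, ∀ i, ∑ k, E t i k * C t k j = C t i j * (l t j - l₀ i) := by
    filter_upwards [hA] with t ht i
    have h1 : E t * C t = C t * Matrix.diagonal (l t) - Matrix.diagonal l₀ * C t := by
      simp only [hC, hE]
      calc _ = U₀.transpose * (A t - A 0) * (U₀ * U₀.transpose) * U t := by
            simp only [Matrix.mul_assoc]
        _ = U₀.transpose * A t * U t - U₀.transpose * A 0 * U t := by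
            rw [mul_transpose_self_of_orthogonal hA₀.orthogonal, Matrix.mul_one, Matrix.mul_sub,
              Matrix.sub_mul]
        _ = U₀.transpose * U t * Matrix.diagonal (l t) * ((U t).transpose * U t) -
            (U₀.transpose * U₀) * Matrix.diagonal l₀ * (U₀.transpose * U t) := by
            conv_lhs => rw [ht.eq, hA₀.eq]
            simp only [Matrix.mul_assoc]
        _ = _ := by
            rw [transpose_mul_self_of_orthogonal hA₀.orthogonal,
              transpose_mul_self_of_orthogonal ht.orthogonal, Matrix.mul_one, Matrix.one_mul]
    have h2 := congrFun (congrFun h1 i) j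
    rw [Matrix.mul_apply, Matrix.sub_apply, Matrix.mul_diagonal, Matrix.diagonal_mul] at h2
    rw [h2]; ring
  have hE0 : ∀ i k, Tendsto (fun t => E t i k) (𝓝[>] 0) (𝓝 0) := by
    intro i k
    have h1 : Tendsto E (𝓝[>] 0) (𝓝 (U₀.transpose * (A 0 - A 0) * U₀)) :=
      (tendsto_const_nhds.mul (hc.sub_const _)).mul tendsto_const_nhds
    simpa using ent h1 i k
  have hbz : ∀ (f : ℝ → ℝ) (k : Fin n), Tendsto f (𝓝[>] 0) (𝓝 0) →
      Tendsto (fun t => f t * C t k j) (𝓝[>] 0) (𝓝 0) := by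
    intro f k hf
    rw [tendsto_zero_iff_abs_tendsto_zero] at hf ⊢
    refine squeeze_zero' (.of_forall fun _ => abs_nonneg _) ?_ hf
    filter_upwards [hbd] with t ht
    simp only [Function.comp_apply, abs_mul]
    exact mul_le_of_le_one_right (abs_nonneg _) (ht k)
  -- Off the diagonal, `C i j` times the gap `l t j - l₀ i` tends to zero, and the gap has a nonzero
  -- limit because the eigenvalues at time 0 are distinct.
  have hoff : ∀ i, i ≠ j → Tendsto (fun t => C t i j) (𝓝[>] 0) (𝓝 0) := by
    intro i hij
    have hne : l₀ j - l₀ i ≠ 0 := sub_ne_zero.mpr fun h => hij (hinj h).symm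
    have h1 : Tendsto (fun t => ∑ k, E t i k * C t k j) (𝓝[>] 0) (𝓝 0) := by
      simpa using tendsto_finsetSum (Finset.univ : Finset (Fin n))
        (fun k _ => hbz _ k (hE0 i k))
    have h2 := h1.div ((hl j).sub_const (l₀ i)) hne
    rw [zero_div] at h2
    refine h2.congr' ?_
    filter_upwards [hrel, ((hl j).sub_const (l₀ i)).eventually_ne hne] with t ht ht'
    simp only [Pi.div_apply]
    rw [ht i, mul_div_cancel_right₀ _ ht']
  have hdiag : Tendsto (fun t => C t j j ^ 2) (𝓝[>] 0) (𝓝 1) := by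
    have h1 : Tendsto (fun t => 1 - ∑ i ∈ Finset.univ.erase j, C t i j ^ 2) (𝓝[>] 0)
        (𝓝 (1 - ∑ i ∈ Finset.univ.erase j, (0 : ℝ) ^ 2)) :=
      tendsto_const_nhds.sub (tendsto_finsetSum _ fun i hi =>
        (hoff i (Finset.ne_of_mem_erase hi)).pow 2)
    simp only [ne_eq, OfNat.ofNat_ne_zero, not_false_eq_true, zero_pow, Finset.sum_const_zero,
      sub_zero] at h1
    refine h1.congr' ?_
    filter_upwards [hcol] with t ht
    rw [← ht, ← Finset.add_sum_erase _ _ (Finset.mem_univ j)]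
    ring
  -- The sign of an eigenvector is arbitrary, so `C t j j` itself need not converge. Products with
  -- `C t j j` remove the ambiguity, and row `j` of the eigenvalue equation is multiplied by it
  -- below.
  have hprod : ∀ k, Tendsto (fun t => C t k j * C t j j) (𝓝[>] 0) (𝓝 (if k = j then 1 else 0)) := by
    intro k
    split_ifs with hk
    · subst hk
      simpa [sq] using hdiag
    · exact hbz _ j (hoff k hk)
  have hEs : Tendsto (fun t => t⁻¹ • E t) (𝓝[>] 0) (𝓝 (U₀.transpose * A' * U₀)) := by
    have h1 : Tendsto (fun t => U₀.transpose * (t⁻¹ • (A t - A 0)) * U₀) (𝓝[>] 0)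
        (𝓝 (U₀.transpose * A' * U₀)) :=
      (tendsto_const_nhds.mul hs).mul tendsto_const_nhds
    simpa only [Matrix.mul_smul, Matrix.smul_mul] using h1
  have hsum : Tendsto (fun t => ∑ k, (t⁻¹ • E t) j k * (C t k j * C t j j)) (𝓝[>] 0)
      (𝓝 ((U₀.transpose * A' * U₀) j j)) := by
    have h1 := tendsto_finsetSum (Finset.univ : Finset (Fin n))
      (fun k _ => (ent hEs j k).mul (hprod k))
    simpa using h1
  have hfin := hsum.div hdiag one_ne_zero
  rw [div_one] at hfin
  refine hfin.congr' ?_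
  filter_upwards [hrel, hdiag.eventually_ne one_ne_zero] with t ht ht'
  simp only [Pi.div_apply]
  rw [div_eq_iff ht']
  calc _ = t⁻¹ * (∑ k, E t j k * C t k j) * C t j j := by
        rw [Finset.mul_sum, Finset.sum_mul]
        refine Finset.sum_congr rfl fun k _ => ?_
        rw [Matrix.smul_apply, smul_eq_mul]; ring
    _ = _ := by rw [ht j]; ring

end Eigenvalues
-- Trace of the square root under prescribed diagonal blocks.
section ExtremalCoupling

variable {p q : ℕ}

theorem IsOrderedEigendecomp.pos {n : ℕ} {A U : Matrix (Fin n) (Fin n) ℝ} {l : Fin n → ℝ}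
    (h : IsOrderedEigendecomp A U l) (hA : A.PosDef) (i : Fin n) : 0 < l i := by
  have hU := transpose_mul_self_of_orthogonal h.orthogonal
  have hu : IsUnit U := IsUnit.of_mul_eq_one _ (mul_transpose_self_of_orthogonal h.orthogonal)
  have h1 := (Matrix.IsUnit.posDef_star_left_conjugate_iff (x := A) hu).mpr hA
  have h2 : star U * A * U = Matrix.diagonal l := by
    rw [Matrix.star_eq_conjTranspose, Matrix.conjTranspose_eq_transpose_of_trivial, h.eq]
    calc _ = (U.transpose * U) * Matrix.diagonal l * (U.transpose * U) := by
          simp only [Matrix.mul_assoc]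
      _ = _ := by rw [hU, Matrix.one_mul, Matrix.mul_one]
  rw [h2, Matrix.posDef_diagonal_iff] at h1
  exact h1 i

/-- Columns are indexed by `Fin (p + q)` to carry the ordering of the eigenvalues; rows keep the sum
type so that they split along the blocks. -/
theorem exists_antitone_diagonalization {T : Matrix (Fin p ⊕ Fin q) (Fin p ⊕ Fin q) ℝ}
    (hT : T.PosSemidef) :
    ∃ (Q : Matrix (Fin p ⊕ Fin q) (Fin (p + q)) ℝ) (μ : Fin (p + q) → ℝ), Antitone μ ∧
      (∀ i, 0 ≤ μ i) ∧ Q.transpose * Q = 1 ∧ T = Q * Matrix.diagonal μ * Q.transpose := by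
  let e : Fin p ⊕ Fin q ≃ Fin (p + q) := finSumFinEquiv
  have hT' : (T.submatrix e.symm e.symm).PosSemidef := hT.submatrix e.symm
  obtain ⟨U, μ, h⟩ := exists_orderedEigendecomp hT'.isHermitian
  have hU := transpose_mul_self_of_orthogonal h.orthogonal
  have hμ : ∀ i, 0 ≤ μ i := by
    have h1 := hT'.conjTranspose_mul_mul_same U
    rw [Matrix.conjTranspose_eq_transpose_of_trivial, h.eq] at h1
    have h2 : U.transpose * (U * Matrix.diagonal μ * U.transpose) * U = Matrix.diagonal μ := by
      calc _ = (U.transpose * U) * Matrix.diagonal μ * (U.transpose * U) := by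
            simp only [Matrix.mul_assoc]
        _ = _ := by rw [hU, Matrix.one_mul, Matrix.mul_one]
    rw [h2] at h1
    exact fun i => by simpa using h1.diag_nonneg (i := i)
  refine ⟨U.submatrix e id, μ, h.antitone, hμ, ?_, ?_⟩
  · rw [Matrix.transpose_submatrix, Matrix.submatrix_mul_equiv, hU, Matrix.submatrix_id_id]
  · have h1 : T = (T.submatrix e.symm e.symm).submatrix e e := by simp
    rw [h1, h.eq, Matrix.transpose_submatrix]
    have h2 := Matrix.submatrix_mul_equiv (U * Matrix.diagonal μ) U.transpose e (Equiv.refl _) e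
    have h3 := Matrix.submatrix_mul_equiv U (Matrix.diagonal μ) e (Equiv.refl _) id
    rw [Equiv.coe_refl] at h2 h3
    rw [← h2, ← h3, Matrix.submatrix_id_id]

/-- The trace of the square root of a positive semi-definite matrix, bounded below by the ordered
eigenvalues of its diagonal blocks. -/
theorem sum_sqrt_pad_le_trace_msqrt (hp : 0 < p) (hq : 0 < q)
    {T : Matrix (Fin p ⊕ Fin q) (Fin p ⊕ Fin q) ℝ} (hT : T.PosSemidef)
    {U₁ : Matrix (Fin p) (Fin p) ℝ} {l₁ : Fin p → ℝ} {U₂ : Matrix (Fin q) (Fin q) ℝ}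
    {l₂ : Fin q → ℝ} (h₁ : IsOrderedEigendecomp T.toBlocks₁₁ U₁ l₁)
    (h₂ : IsOrderedEigendecomp T.toBlocks₂₂ U₂ l₂) (hl₁ : ∀ i, 0 < l₁ i) (hl₂ : ∀ i, 0 < l₂ i) :
    ∑ j : Fin (p + q), √(pad l₁ j + pad l₂ j) ≤ (msqrt T).trace := by
  obtain ⟨Q, μ, hanti, hμ, hQ, hTQ⟩ := exists_antitone_diagonalization hT
  have htr : (msqrt T).trace = ∑ i, √(μ i) := by
    conv_lhs => rw [hTQ]
    rw [msqrt_orthogonal_conj_diagonal hQ hμ, trace_orthogonal_conj hQ, Matrix.trace_diagonal]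
  have hQ₁ : (Q.submatrix Sum.inl id) * Matrix.diagonal μ * (Q.submatrix Sum.inl id).transpose =
      T.toBlocks₁₁ := by
    rw [hTQ]
    ext i j
    simp [Matrix.mul_apply, Matrix.toBlocks₁₁, Matrix.diagonal_apply]
  have hQ₂ : (Q.submatrix Sum.inr id) * Matrix.diagonal μ * (Q.submatrix Sum.inr id).transpose =
      T.toBlocks₂₂ := by
    rw [hTQ]
    ext i j
    simp [Matrix.mul_apply, Matrix.toBlocks₂₂, Matrix.diagonal_apply]
  -- Unit columns: the squared norms of the two row blocks of a column add to one, so adding the two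
  -- frame bounds restores the full `∑ w μ`.
  have hcol : ∀ i, ∑ a, Q (Sum.inl a) i ^ 2 + ∑ b, Q (Sum.inr b) i ^ 2 = 1 := by
    intro i
    simpa [Matrix.mul_apply, sq] using congrFun (congrFun hQ i) i
  -- Eigenvalues `μ i` may vanish, where the square root has no finite slope; the shift by `ε`
  -- avoids this and is removed by a limit at the end. The weights `w` are tangent slopes,
  -- increasing because `μ` is decreasing.
  have key : ∀ ε : ℝ, 0 < ε → ∑ j : Fin (p + q), √(pad l₁ j + pad l₂ j) ≤
      ∑ i, √(μ i + ε) := by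
    intro ε hε
    have hpos : ∀ i, 0 < √(μ i + ε) := fun i => Real.sqrt_pos.mpr (by linarith [hμ i])
    set w : Fin (p + q) → ℝ := fun i => (2 * √(μ i + ε))⁻¹ with hw
    have hwm : Monotone w := by
      intro i j hij
      have := hanti hij
      have := Real.sqrt_le_sqrt (add_le_add_left this ε)
      exact inv_anti₀ (mul_pos two_pos (hpos j)) (by linarith)
    have b₁ := sum_pad_mul_le_of_frame (d := p + q) (by omega) h₁ hl₁ hμ hwm hQ₁
    have b₂ := sum_pad_mul_le_of_frame (d := p + q) (by omega) h₂ hl₂ hμ hwm hQ₂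
    have b : ∑ j : Fin (p + q), w j * (pad l₁ j + pad l₂ j) ≤ ∑ j, w j * μ j := by
      calc _ = ∑ j : Fin (p + q), pad l₁ j * w j + ∑ j : Fin (p + q), pad l₂ j * w j := by
            rw [← Finset.sum_add_distrib]
            exact Finset.sum_congr rfl fun j _ => by ring
        _ ≤ _ := add_le_add b₁ b₂
        _ = _ := by
            rw [← Finset.sum_add_distrib]
            refine Finset.sum_congr rfl fun j _ => ?_
            simp only [Matrix.submatrix_apply, id_eq]
            rw [← mul_add, ← mul_add, hcol, mul_one]
    -- A concave function lies below its tangent, here the one at `μ j + ε`; the gap is `(a - b)² /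
    -- (2b)`.
    have tangent : ∀ j : Fin (p + q), √(pad l₁ j + pad l₂ j) ≤
        √(μ j + ε) + (w j * (pad l₁ j + pad l₂ j) - w j * μ j) := by
      intro j
      have hs : 0 ≤ pad l₁ j + pad l₂ j :=
        add_nonneg (pad_nonneg (fun i => (hl₁ i).le) j) (pad_nonneg (fun i => (hl₂ i).le) j)
      refine (Real.sqrt_le_sqrt (le_add_of_nonneg_right hε.le)).trans ?_
      set a := √(pad l₁ j + pad l₂ j + ε) with ha
      set b := √(μ j + ε) with hb
      have ha2 : a ^ 2 = pad l₁ j + pad l₂ j + ε := Real.sq_sqrt (by linarith)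
      have hb2 : b ^ 2 = μ j + ε := Real.sq_sqrt (by linarith [hμ j])
      have hb0 : 0 < b := hpos j
      have : w j * (pad l₁ j + pad l₂ j) - w j * μ j = (a ^ 2 - b ^ 2) / (2 * b) := by
        rw [ha2, hb2, hw, div_eq_inv_mul]; ring
      rw [this, ← sub_nonneg]
      have : b + (a ^ 2 - b ^ 2) / (2 * b) - a = (a - b) ^ 2 / (2 * b) := by
        field_simp; ring
      rw [this]
      positivity
    have := Finset.sum_le_sum fun j (_ : j ∈ Finset.univ) => tangent j
    rw [Finset.sum_add_distrib, Finset.sum_sub_distrib] at this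
    linarith
  have hlim : Tendsto (fun ε : ℝ => ∑ i, √(μ i + ε)) (𝓝[>] 0) (𝓝 (∑ i, √(μ i))) := by
    have : Continuous fun ε : ℝ => ∑ i, √(μ i + ε) := by fun_prop
    simpa using (this.tendsto 0).mono_left nhdsWithin_le_nhds
  rw [htr]
  refine ge_of_tendsto hlim ?_
  filter_upwards [self_mem_nhdsWithin] with ε hε using key ε hε

/-- `Y Yᵀ` has the nonzero eigenvalues of `Yᵀ Y`, and its root is `Y diag(s^{-1/2}) Yᵀ`. Where `s j
= 0` the column `j` of `Y` vanishes, so the convention `0⁻¹ = 0` is harmless. -/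
theorem trace_msqrt_mul_transpose {m n : Type} [Fintype m] [DecidableEq m] [Fintype n]
    [DecidableEq n] {Y : Matrix m n ℝ} {s : n → ℝ} (hY : Y.transpose * Y = Matrix.diagonal s) :
    (msqrt (Y * Y.transpose)).trace = ∑ j, √(s j) := by
  have hs : ∀ j, s j = ∑ a, Y a j ^ 2 := by
    intro j
    have := congrFun (congrFun hY j) j
    rw [Matrix.diagonal_apply_eq] at this
    rw [← this]
    simp [Matrix.mul_apply, sq]
  have hs0 : ∀ j, 0 ≤ s j := fun j => by rw [hs]; positivity
  have hroot : msqrt (Y * Y.transpose) =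
      Y * Matrix.diagonal (fun j => (√(s j))⁻¹) * Y.transpose := by
    refine msqrt_unique ?_ (posSemidef_conj_diagonal Y fun j => by positivity)
    calc _ = Y * (Matrix.diagonal (fun j => (√(s j))⁻¹) * (Y.transpose * Y) *
          Matrix.diagonal (fun j => (√(s j))⁻¹)) * Y.transpose := by simp only [Matrix.mul_assoc]
      _ = Y * Y.transpose := by
        rw [hY, Matrix.diagonal_mul_diagonal, Matrix.diagonal_mul_diagonal]
        congr 1
        ext a j
        rw [Matrix.mul_diagonal]
        rcases (hs0 j).eq_or_lt with h | h
        · have h0 : Y a j = 0 := by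
            rw [hs] at h
            have := (Finset.sum_eq_zero_iff_of_nonneg fun a _ => sq_nonneg (Y a j)).mp h.symm a
              (Finset.mem_univ a)
            exact pow_eq_zero_iff two_ne_zero |>.mp this
          rw [h0, zero_mul]
        · have h1 : √(s j) ≠ 0 := (Real.sqrt_pos.mpr h).ne'
          nth_rewrite 2 [← Real.mul_self_sqrt h.le]
          field_simp
  rw [hroot, Matrix.mul_assoc, Matrix.trace_mul_comm, Matrix.mul_assoc, hY,
    Matrix.diagonal_mul_diagonal, Matrix.trace_diagonal]
  refine Finset.sum_congr rfl fun j _ => ?_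
  rw [inv_mul_eq_div, Real.div_sqrt]

/-- The matrix with entry `g₁ a` (resp. `g₂ b`) in the column with the index of the row. -/
def alignedColumns (g₁ : Fin p → ℝ) (g₂ : Fin q → ℝ) : Matrix (Fin p ⊕ Fin q) (Fin (p + q)) ℝ :=
  Matrix.of fun c j => Sum.elim (fun a : Fin p => if (a : ℕ) = j then g₁ a else 0)
    (fun b : Fin q => if (b : ℕ) = j then g₂ b else 0) c

theorem sum_ite_val_eq_pad {n : ℕ} (g : Fin n → ℝ) (j : ℕ) :
    ∑ a : Fin n, (if (a : ℕ) = j then g a else 0) = pad g j := by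
  unfold pad
  split_ifs with h
  · rw [Finset.sum_eq_single ⟨j, h⟩]
    · simp
    · intro b _ hb
      rw [if_neg fun hh => hb (Fin.ext hh)]
    · simp
  · refine Finset.sum_eq_zero fun a _ => if_neg fun hh => h (by omega)

/-- Each row has at most one nonzero entry, so distinct columns have disjoint supports and are
orthogonal. -/
theorem alignedColumns_transpose_mul_self (g₁ : Fin p → ℝ) (g₂ : Fin q → ℝ) :
    (alignedColumns g₁ g₂).transpose * alignedColumns g₁ g₂ =
      Matrix.diagonal fun j : Fin (p + q) =>
        pad (fun a => g₁ a ^ 2) j + pad (fun b => g₂ b ^ 2) j := by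
  ext i j
  rw [Matrix.mul_apply, Fintype.sum_sum_type, Matrix.diagonal_apply]
  split_ifs with h
  · subst h
    rw [← sum_ite_val_eq_pad, ← sum_ite_val_eq_pad]
    congr 1 <;>
    · refine Finset.sum_congr rfl fun a _ => ?_
      simp only [alignedColumns, Matrix.transpose_apply, Matrix.of_apply, Sum.elim_inl,
        Sum.elim_inr]
      split_ifs <;> ring
  · have h' : (i : ℕ) ≠ j := fun hh => h (Fin.ext hh)
    rw [Finset.sum_eq_zero, Finset.sum_eq_zero, add_zero]
    all_goals
      intro a _
      simp only [alignedColumns, Matrix.transpose_apply, Matrix.of_apply, Sum.elim_inl,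
        Sum.elim_inr]
      split_ifs <;> simp_all

theorem alignedColumns_mul_transpose (g₁ : Fin p → ℝ) (g₂ : Fin q → ℝ) :
    alignedColumns g₁ g₂ * (alignedColumns g₁ g₂).transpose =
      Matrix.fromBlocks (Matrix.diagonal fun a => g₁ a ^ 2)
        (Matrix.diagonal g₁ * Matrix.of (fun (i : Fin p) (j : Fin q) =>
          if (i : ℕ) = (j : ℕ) then (1 : ℝ) else 0) * Matrix.diagonal g₂)
        (Matrix.diagonal g₁ * Matrix.of (fun (i : Fin p) (j : Fin q) =>
          if (i : ℕ) = (j : ℕ) then (1 : ℝ) else 0) * Matrix.diagonal g₂).transpose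
        (Matrix.diagonal fun b => g₂ b ^ 2) := by
  have aux : ∀ (x y : ℕ) (u v : ℝ), x < p + q →
      ∑ j : Fin (p + q), (if x = j then u else 0) * (if y = j then v else 0) =
        if x = y then u * v else 0 := by
    intro x y u v hx
    rw [Finset.sum_eq_single ⟨x, hx⟩]
    · by_cases h : x = y <;> simp [h, eq_comm]
    · intro j _ hj
      rw [if_neg fun hh => hj (Fin.ext hh.symm), zero_mul]
    · simp
  ext c d
  rw [Matrix.mul_apply]
  rcases c with a | b <;> rcases d with a' | b' <;>
    simp only [Matrix.transpose_apply, alignedColumns, Matrix.of_apply,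
      Sum.elim_inl, Sum.elim_inr, Matrix.fromBlocks_apply₁₁, Matrix.fromBlocks_apply₁₂,
      Matrix.fromBlocks_apply₂₁, Matrix.fromBlocks_apply₂₂]
  · rw [aux _ _ _ _ (by omega), Matrix.diagonal_apply]
    by_cases h : a = a'
    · subst h; simp [sq]
    · simp [h, Fin.val_inj]
  · rw [aux _ _ _ _ (by omega)]
    rw [Matrix.mul_diagonal, Matrix.diagonal_mul, Matrix.of_apply]
    split_ifs <;> simp
  · rw [aux _ _ _ _ (by omega)]
    rw [Matrix.mul_diagonal, Matrix.diagonal_mul, Matrix.of_apply]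
    by_cases h : (b : ℕ) = a'
    · simp [h, mul_comm]
    · simp [h, Ne.symm h]
  · rw [aux _ _ _ _ (by omega), Matrix.diagonal_apply]
    by_cases h : b = b'
    · subst h; simp [sq]
    · simp [h, Fin.val_inj]

end ExtremalCoupling
-- Block matrices and closed forms of the coefficients.
section Coefficients

variable {p q : ℕ}

theorem pad_comp {n : ℕ} (f : ℝ → ℝ) (hf : f 0 = 0) (l : Fin n → ℝ) (j : ℕ) :
    pad (fun a => f (l a)) j = f (pad l j) := by
  unfold pad
  split_ifs
  · rfl
  · exact hf.symm

theorem diagonal_mul_alignedColumns (d₁ g₁ : Fin p → ℝ) (d₂ g₂ : Fin q → ℝ) :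
    Matrix.fromBlocks (Matrix.diagonal d₁) 0 0 (Matrix.diagonal d₂) * alignedColumns g₁ g₂ =
      alignedColumns (fun a => d₁ a * g₁ a) (fun b => d₂ b * g₂ b) := by
  rw [Matrix.fromBlocks_diagonal]
  ext c j
  rw [Matrix.diagonal_mul]
  rcases c with a | b <;> simp [alignedColumns]

theorem toBlocks₁₁_posSemidef {S : Matrix (Fin p ⊕ Fin q) (Fin p ⊕ Fin q) ℝ}
    (hS : S.PosSemidef) : S.toBlocks₁₁.PosSemidef := hS.submatrix Sum.inl

theorem toBlocks₂₂_posSemidef {S : Matrix (Fin p ⊕ Fin q) (Fin p ⊕ Fin q) ℝ}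
    (hS : S.PosSemidef) : S.toBlocks₂₂.PosSemidef := hS.submatrix Sum.inr

theorem toBlocks₁₁_posDef {S : Matrix (Fin p ⊕ Fin q) (Fin p ⊕ Fin q) ℝ}
    (hS : S.PosDef) : S.toBlocks₁₁.PosDef := hS.submatrix Sum.inl_injective

theorem toBlocks₂₂_posDef {S : Matrix (Fin p ⊕ Fin q) (Fin p ⊕ Fin q) ℝ}
    (hS : S.PosDef) : S.toBlocks₂₂.PosDef := hS.submatrix Sum.inr_injective

theorem blockDiagPart_posSemidef {S : Matrix (Fin p ⊕ Fin q) (Fin p ⊕ Fin q) ℝ}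
    (hS : S.PosSemidef) : (blockDiagPart S).PosSemidef :=
  posSemidef_fromBlocks_diag (toBlocks₁₁_posSemidef hS) (toBlocks₂₂_posSemidef hS)

theorem blockDiagPart_posDef {S : Matrix (Fin p ⊕ Fin q) (Fin p ⊕ Fin q) ℝ}
    (hS : S.PosDef) : (blockDiagPart S).PosDef := by
  rw [(blockDiagPart_posSemidef hS.posSemidef).posDef_iff_det_ne_zero, blockDiagPart,
    Matrix.det_fromBlocks_zero₂₁]
  exact mul_ne_zero (toBlocks₁₁_posDef hS).det_pos.ne' (toBlocks₂₂_posDef hS).det_pos.ne'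

theorem trace_eq_add_toBlocks (S : Matrix (Fin p ⊕ Fin q) (Fin p ⊕ Fin q) ℝ) :
    S.trace = S.toBlocks₁₁.trace + S.toBlocks₂₂.trace := by
  simp [Matrix.trace, Matrix.toBlocks₁₁, Matrix.toBlocks₂₂]

theorem trace_blockDiagPart (S : Matrix (Fin p ⊕ Fin q) (Fin p ⊕ Fin q) ℝ) :
    (blockDiagPart S).trace = S.trace := by
  rw [trace_eq_add_toBlocks, trace_eq_add_toBlocks S]; rfl

theorem msqrt_blockDiagPart {S : Matrix (Fin p ⊕ Fin q) (Fin p ⊕ Fin q) ℝ}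
    (hS : S.PosSemidef) : msqrt (blockDiagPart S) =
      Matrix.fromBlocks (msqrt S.toBlocks₁₁) 0 0 (msqrt S.toBlocks₂₂) :=
  msqrt_fromBlocks_diag (toBlocks₁₁_posSemidef hS) (toBlocks₂₂_posSemidef hS)

theorem trace_msqrt_blockDiagPart {S : Matrix (Fin p ⊕ Fin q) (Fin p ⊕ Fin q) ℝ}
    (hS : S.PosSemidef) : (msqrt (blockDiagPart S)).trace =
      (msqrt S.toBlocks₁₁).trace + (msqrt S.toBlocks₂₂).trace := by
  rw [msqrt_blockDiagPart hS, trace_eq_add_toBlocks]; rfl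

theorem coupling_spec {S₁ : Matrix (Fin p) (Fin p) ℝ} {S₂ : Matrix (Fin q) (Fin q) ℝ}
    {T : Matrix (Fin p ⊕ Fin q) (Fin p ⊕ Fin q) ℝ} (hT : T ∈ Coupling S₁ S₂) :
    T.PosSemidef ∧ T.toBlocks₁₁ = S₁ ∧ T.toBlocks₂₂ = S₂ := by
  obtain ⟨h, Y, rfl⟩ := hT
  exact ⟨h, rfl, rfl⟩

/-! ### The extremal coupling and the values of the suprema. -/

section Extremal

variable {S : Matrix (Fin p ⊕ Fin q) (Fin p ⊕ Fin q) ℝ}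
  {U₁ : Matrix (Fin p) (Fin p) ℝ} {l₁ : Fin p → ℝ} {U₂ : Matrix (Fin q) (Fin q) ℝ}
  {l₂ : Fin q → ℝ}

theorem blockOrthogonal_transpose_mul_self {U₁ : Matrix (Fin p) (Fin p) ℝ}
    {U₂ : Matrix (Fin q) (Fin q) ℝ} (h₁ : U₁ ∈ Matrix.orthogonalGroup (Fin p) ℝ)
    (h₂ : U₂ ∈ Matrix.orthogonalGroup (Fin q) ℝ) :
    (Matrix.fromBlocks U₁ 0 0 U₂).transpose * Matrix.fromBlocks U₁ 0 0 U₂ = 1 := by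
  simp [Matrix.fromBlocks_transpose, Matrix.fromBlocks_multiply,
    transpose_mul_self_of_orthogonal h₁, transpose_mul_self_of_orthogonal h₂]

/-- This factorisation gives positive semi-definiteness and the trace of the root at once. -/
theorem SigmaMax_eq_mul_transpose (h₁ : IsOrderedEigendecomp S.toBlocks₁₁ U₁ l₁)
    (h₂ : IsOrderedEigendecomp S.toBlocks₂₂ U₂ l₂) (hl₁ : ∀ i, 0 < l₁ i) (hl₂ : ∀ i, 0 < l₂ i) :
    SigmaMax S U₁ l₁ U₂ l₂ =
      Matrix.fromBlocks U₁ 0 0 U₂ * alignedColumns (fun a => √(l₁ a)) (fun b => √(l₂ b)) *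
        (Matrix.fromBlocks U₁ 0 0 U₂ *
          alignedColumns (fun a => √(l₁ a)) (fun b => √(l₂ b))).transpose := by
  rw [Matrix.transpose_mul, Matrix.mul_assoc, ← Matrix.mul_assoc (alignedColumns _ _),
    alignedColumns_mul_transpose, Matrix.fromBlocks_transpose, Matrix.fromBlocks_multiply,
    Matrix.fromBlocks_multiply, SigmaMax, PsiMax]
  simp only [Real.sq_sqrt (hl₁ _).le, Real.sq_sqrt (hl₂ _).le]
  congr 1
  · rw [h₁.eq]; simp [Matrix.mul_assoc]
  · simp [Matrix.mul_assoc]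
  · simp [Matrix.mul_assoc]
  · rw [h₂.eq]; simp [Matrix.mul_assoc]

theorem trace_msqrt_SigmaMax (h₁ : IsOrderedEigendecomp S.toBlocks₁₁ U₁ l₁)
    (h₂ : IsOrderedEigendecomp S.toBlocks₂₂ U₂ l₂) (hl₁ : ∀ i, 0 < l₁ i) (hl₂ : ∀ i, 0 < l₂ i) :
    (msqrt (SigmaMax S U₁ l₁ U₂ l₂)).trace = ∑ j : Fin (p + q), √(pad l₁ j + pad l₂ j) := by
  rw [SigmaMax_eq_mul_transpose h₁ h₂ hl₁ hl₂]
  refine trace_msqrt_mul_transpose ?_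
  rw [Matrix.transpose_mul, Matrix.mul_assoc,
    ← Matrix.mul_assoc (Matrix.fromBlocks U₁ 0 0 U₂).transpose,
    blockOrthogonal_transpose_mul_self h₁.orthogonal h₂.orthogonal, Matrix.one_mul,
    alignedColumns_transpose_mul_self]
  simp only [Real.sq_sqrt (hl₁ _).le, Real.sq_sqrt (hl₂ _).le]

theorem SigmaMax_mem_coupling (h₁ : IsOrderedEigendecomp S.toBlocks₁₁ U₁ l₁)
    (h₂ : IsOrderedEigendecomp S.toBlocks₂₂ U₂ l₂) (hl₁ : ∀ i, 0 < l₁ i) (hl₂ : ∀ i, 0 < l₂ i) :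
    SigmaMax S U₁ l₁ U₂ l₂ ∈ Coupling S.toBlocks₁₁ S.toBlocks₂₂ := by
  refine ⟨?_, PsiMax U₁ l₁ U₂ l₂, rfl⟩
  rw [SigmaMax_eq_mul_transpose h₁ h₂ hl₁ hl₂]
  have := Matrix.posSemidef_self_mul_conjTranspose (Matrix.fromBlocks U₁ 0 0 U₂ *
    alignedColumns (fun a => √(l₁ a)) (fun b => √(l₂ b)))
  rwa [Matrix.conjTranspose_eq_transpose_of_trivial] at this

theorem IsOrderedEigendecomp.msqrt_eq {n : ℕ} {A U : Matrix (Fin n) (Fin n) ℝ} {l : Fin n → ℝ}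
    (h : IsOrderedEigendecomp A U l) (hl : ∀ i, 0 < l i) :
    msqrt A = U * Matrix.diagonal (fun i => √(l i)) * U.transpose := by
  conv_lhs => rw [h.eq]
  exact msqrt_orthogonal_conj_diagonal (transpose_mul_self_of_orthogonal h.orthogonal)
    fun i => (hl i).le

theorem IsOrderedEigendecomp.mul_self {n : ℕ} {A U : Matrix (Fin n) (Fin n) ℝ} {l : Fin n → ℝ}
    (h : IsOrderedEigendecomp A U l) (hl : ∀ i, 0 < l i) :
    IsOrderedEigendecomp (A * A) U (fun i => l i ^ 2) := by
  refine ⟨h.orthogonal, fun i j hij => pow_le_pow_left₀ (hl j).le (h.antitone hij) 2, ?_⟩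
  rw [h.eq, orthogonal_conj_mul (transpose_mul_self_of_orthogonal h.orthogonal),
    Matrix.diagonal_mul_diagonal]
  simp only [sq]

/-- The root of the block diagonal part multiplies the factor of `SigmaMax` and turns its entries
`√l` into `l`; the column norms then become sums of squares. -/
theorem fidelity_blockDiagPart_SigmaMax (hS : S.PosSemidef)
    (h₁ : IsOrderedEigendecomp S.toBlocks₁₁ U₁ l₁)
    (h₂ : IsOrderedEigendecomp S.toBlocks₂₂ U₂ l₂) (hl₁ : ∀ i, 0 < l₁ i) (hl₂ : ∀ i, 0 < l₂ i) :
    fidelity (blockDiagPart S) (SigmaMax S U₁ l₁ U₂ l₂) =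
      ∑ j : Fin (p + q), √(pad l₁ j ^ 2 + pad l₂ j ^ 2) := by
  set W := Matrix.fromBlocks U₁ 0 0 U₂ with hW
  have hWW : W.transpose * W = 1 :=
    blockOrthogonal_transpose_mul_self h₁.orthogonal h₂.orthogonal
  set D := Matrix.fromBlocks (Matrix.diagonal fun a => √(l₁ a)) 0 0
    (Matrix.diagonal fun b => √(l₂ b)) with hD
  have hroot : msqrt (blockDiagPart S) = W * D * W.transpose := by
    rw [msqrt_blockDiagPart hS, h₁.msqrt_eq hl₁, h₂.msqrt_eq hl₂, hW, hD]
    simp [Matrix.fromBlocks_transpose, Matrix.fromBlocks_multiply, -Matrix.fromBlocks_diagonal]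
  have hY : msqrt (blockDiagPart S) * (W * alignedColumns (fun a => √(l₁ a)) fun b => √(l₂ b)) =
      W * alignedColumns l₁ l₂ := by
    rw [hroot]
    calc _ = W * D * (W.transpose * W) * alignedColumns (fun a => √(l₁ a)) (fun b => √(l₂ b)) := by
          simp only [Matrix.mul_assoc]
      _ = W * (D * alignedColumns (fun a => √(l₁ a)) fun b => √(l₂ b)) := by
          rw [hWW, Matrix.mul_one, Matrix.mul_assoc]
      _ = _ := by
          rw [hD, diagonal_mul_alignedColumns]
          simp only [Real.mul_self_sqrt (hl₁ _).le, Real.mul_self_sqrt (hl₂ _).le]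
  have hM : msqrt (blockDiagPart S) * SigmaMax S U₁ l₁ U₂ l₂ * msqrt (blockDiagPart S) =
      W * alignedColumns l₁ l₂ * (W * alignedColumns l₁ l₂).transpose := by
    rw [SigmaMax_eq_mul_transpose h₁ h₂ hl₁ hl₂, ← hW, ← hY, Matrix.transpose_mul (msqrt _),
      msqrt_transpose]
    simp only [Matrix.mul_assoc]
  rw [fidelity, hM]
  refine trace_msqrt_mul_transpose ?_
  rw [Matrix.transpose_mul, Matrix.mul_assoc, ← Matrix.mul_assoc W.transpose, hWW,
    Matrix.one_mul, alignedColumns_transpose_mul_self]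
  congr 1
  funext j
  rw [pad_comp (· ^ 2) (by simp), pad_comp (· ^ 2) (by simp)]

theorem dW2_one {n : Type} [Fintype n] [DecidableEq n] {T : Matrix n n ℝ} (hT : T.PosSemidef) :
    dW2 T 1 = T.trace + Fintype.card n - 2 * (msqrt T).trace := by
  rw [dW2, Matrix.mul_one, msqrt_mul_self hT, Matrix.trace_one]

theorem dW2_eq_fidelity {n : Type} [Fintype n] [DecidableEq n] (S X : Matrix n n ℝ) :
    dW2 S X = S.trace + X.trace - 2 * fidelity S X := rfl

theorem sSup_dW2_one (hp : 0 < p) (hq : 0 < q)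
    (h₁ : IsOrderedEigendecomp S.toBlocks₁₁ U₁ l₁)
    (h₂ : IsOrderedEigendecomp S.toBlocks₂₂ U₂ l₂) (hl₁ : ∀ i, 0 < l₁ i) (hl₂ : ∀ i, 0 < l₂ i) :
    sSup ((fun T => dW2 T 1) '' Coupling S.toBlocks₁₁ S.toBlocks₂₂) =
      S.trace + Fintype.card (Fin p ⊕ Fin q) -
        2 * ∑ j : Fin (p + q), √(pad l₁ j + pad l₂ j) := by
  refine IsGreatest.csSup_eq ⟨⟨_, SigmaMax_mem_coupling h₁ h₂ hl₁ hl₂, ?_⟩, ?_⟩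
  · have hT := coupling_spec (SigmaMax_mem_coupling h₁ h₂ hl₁ hl₂)
    simp only
    rw [dW2_one hT.1, trace_msqrt_SigmaMax h₁ h₂ hl₁ hl₂, trace_eq_add_toBlocks, hT.2.1, hT.2.2,
      ← trace_eq_add_toBlocks]
  · rintro _ ⟨T, hT, rfl⟩
    obtain ⟨hT, hT₁, hT₂⟩ := coupling_spec hT
    simp only
    rw [dW2_one hT, trace_eq_add_toBlocks T, hT₁, hT₂, ← trace_eq_add_toBlocks]
    have := sum_sqrt_pad_le_trace_msqrt hp hq hT (hT₁ ▸ h₁) (hT₂ ▸ h₂) hl₁ hl₂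
    linarith

theorem sSup_dW2_blockDiagPart (hp : 0 < p) (hq : 0 < q) (hS : S.PosSemidef)
    (h₁ : IsOrderedEigendecomp S.toBlocks₁₁ U₁ l₁)
    (h₂ : IsOrderedEigendecomp S.toBlocks₂₂ U₂ l₂) (hl₁ : ∀ i, 0 < l₁ i) (hl₂ : ∀ i, 0 < l₂ i) :
    sSup ((fun T => dW2 T (blockDiagPart S)) '' Coupling S.toBlocks₁₁ S.toBlocks₂₂) =
      2 * (S.trace - ∑ j : Fin (p + q), √(pad l₁ j ^ 2 + pad l₂ j ^ 2)) := by
  have hS₀ := blockDiagPart_posSemidef hS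
  refine IsGreatest.csSup_eq ⟨⟨_, SigmaMax_mem_coupling h₁ h₂ hl₁ hl₂, ?_⟩, ?_⟩
  · have hT := coupling_spec (SigmaMax_mem_coupling h₁ h₂ hl₁ hl₂)
    simp only
    rw [dW2_eq_fidelity, fidelity_comm hT.1 hS₀, fidelity_blockDiagPart_SigmaMax hS h₁ h₂ hl₁ hl₂,
      trace_blockDiagPart, trace_eq_add_toBlocks (SigmaMax _ _ _ _ _), hT.2.1, hT.2.2,
      ← trace_eq_add_toBlocks]
    ring
  · rintro _ ⟨T, hT, rfl⟩
    obtain ⟨hT, hT₁, hT₂⟩ := coupling_spec hT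
    simp only
    rw [dW2_eq_fidelity, fidelity_comm hT hS₀, trace_blockDiagPart, trace_eq_add_toBlocks T, hT₁,
      hT₂, ← trace_eq_add_toBlocks]
    have hM := msqrt_conj_posSemidef (blockDiagPart S) hT
    have conj : ∀ {n : ℕ} {A : Matrix (Fin n) (Fin n) ℝ}, A.PosSemidef →
        msqrt A * A * msqrt A = A * A := by
      intro n A hA
      nth_rewrite 2 [← msqrt_mul_self hA]
      rw [← Matrix.mul_assoc, msqrt_mul_self hA, Matrix.mul_assoc, msqrt_mul_self hA]
    have hblocks : msqrt (blockDiagPart S) * T * msqrt (blockDiagPart S) =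
        Matrix.fromBlocks (msqrt S.toBlocks₁₁ * T.toBlocks₁₁ * msqrt S.toBlocks₁₁)
          (msqrt S.toBlocks₁₁ * T.toBlocks₁₂ * msqrt S.toBlocks₂₂)
          (msqrt S.toBlocks₂₂ * T.toBlocks₂₁ * msqrt S.toBlocks₁₁)
          (msqrt S.toBlocks₂₂ * T.toBlocks₂₂ * msqrt S.toBlocks₂₂) := by
      conv_lhs => rw [msqrt_blockDiagPart hS, ← Matrix.fromBlocks_toBlocks T]
      simp [Matrix.fromBlocks_multiply]
    -- Conjugation gives every coupling the diagonal blocks `S₁²` and `S₂²`, so the lower bound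
    -- applies with squared eigenvalues.
    have hb₁ : (msqrt (blockDiagPart S) * T * msqrt (blockDiagPart S)).toBlocks₁₁ =
        S.toBlocks₁₁ * S.toBlocks₁₁ := by
      rw [hblocks, Matrix.toBlocks_fromBlocks₁₁, hT₁, conj (toBlocks₁₁_posSemidef hS)]
    have hb₂ : (msqrt (blockDiagPart S) * T * msqrt (blockDiagPart S)).toBlocks₂₂ =
        S.toBlocks₂₂ * S.toBlocks₂₂ := by
      rw [hblocks, Matrix.toBlocks_fromBlocks₂₂, hT₂, conj (toBlocks₂₂_posSemidef hS)]
    have := sum_sqrt_pad_le_trace_msqrt hp hq hM (hb₁ ▸ h₁.mul_self hl₁) (hb₂ ▸ h₂.mul_self hl₂)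
      (fun i => pow_pos (hl₁ i) 2) (fun i => pow_pos (hl₂ i) 2)
    simp only [fun l : Fin p → ℝ => pad_comp (· ^ 2) (by simp) l,
      fun l : Fin q → ℝ => pad_comp (· ^ 2) (by simp) l] at this
    rw [← fidelity] at this
    linarith

/-- Traces and dimensions cancel, as does a common factor 2. The result depends only on traces of
roots and on eigenvalues, so it can be differentiated without following the optimal coupling. -/
theorem dep₁_eq (hp : 0 < p) (hq : 0 < q) (hS : S.PosSemidef)
    (h₁ : IsOrderedEigendecomp S.toBlocks₁₁ U₁ l₁)
    (h₂ : IsOrderedEigendecomp S.toBlocks₂₂ U₂ l₂) (hl₁ : ∀ i, 0 < l₁ i) (hl₂ : ∀ i, 0 < l₂ i) :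
    dep₁ S = ((msqrt (blockDiagPart S)).trace - (msqrt S).trace) /
      ((msqrt (blockDiagPart S)).trace - ∑ j : Fin (p + q), √(pad l₁ j + pad l₂ j)) := by
  rw [dep₁, sSup_dW2_one hp hq h₁ h₂ hl₁ hl₂, dW2_one hS, dW2_one (toBlocks₁₁_posSemidef hS),
    dW2_one (toBlocks₂₂_posSemidef hS), trace_msqrt_blockDiagPart hS, trace_eq_add_toBlocks S]
  conv_rhs => rw [← mul_div_mul_left _ _ (two_ne_zero (α := ℝ))]
  simp only [Fintype.card_sum, Fintype.card_fin, Nat.cast_add]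
  congr 1 <;> ring

theorem dep₂_eq (hp : 0 < p) (hq : 0 < q) (hS : S.PosSemidef)
    (h₁ : IsOrderedEigendecomp S.toBlocks₁₁ U₁ l₁)
    (h₂ : IsOrderedEigendecomp S.toBlocks₂₂ U₂ l₂) (hl₁ : ∀ i, 0 < l₁ i) (hl₂ : ∀ i, 0 < l₂ i) :
    dep₂ S = (S.trace - fidelity (blockDiagPart S) S) /
      (S.trace - ∑ j : Fin (p + q), √(pad l₁ j ^ 2 + pad l₂ j ^ 2)) := by
  rw [dep₂, sSup_dW2_blockDiagPart hp hq hS h₁ h₂ hl₁ hl₂, dW2_eq_fidelity,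
    fidelity_comm hS (blockDiagPart_posSemidef hS), trace_blockDiagPart]
  conv_rhs => rw [← mul_div_mul_left _ _ (two_ne_zero (α := ℝ))]
  congr 1; ring

theorem c₁_eq (hS : S.PosSemidef)
    (h₁ : IsOrderedEigendecomp S.toBlocks₁₁ U₁ l₁)
    (h₂ : IsOrderedEigendecomp S.toBlocks₂₂ U₂ l₂) (hl₁ : ∀ i, 0 < l₁ i) (hl₂ : ∀ i, 0 < l₂ i) :
    c₁ S U₁ l₁ U₂ l₂ = (msqrt (blockDiagPart S)).trace -
      ∑ j : Fin (p + q), √(pad l₁ j + pad l₂ j) := by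
  rw [c₁, trace_msqrt_SigmaMax h₁ h₂ hl₁ hl₂, trace_msqrt_blockDiagPart hS]

theorem c₂_eq (hS : S.PosSemidef)
    (h₁ : IsOrderedEigendecomp S.toBlocks₁₁ U₁ l₁)
    (h₂ : IsOrderedEigendecomp S.toBlocks₂₂ U₂ l₂) (hl₁ : ∀ i, 0 < l₁ i) (hl₂ : ∀ i, 0 < l₂ i) :
    c₂ S U₁ l₁ U₂ l₂ = S.trace - ∑ j : Fin (p + q), √(pad l₁ j ^ 2 + pad l₂ j ^ 2) := by
  rw [c₂, ← fidelity, fidelity_blockDiagPart_SigmaMax hS h₁ h₂ hl₁ hl₂]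

theorem sum_pad {n d : ℕ} (h : n ≤ d) (l : Fin n → ℝ) : ∑ j : Fin d, pad l j = ∑ i, l i := by
  obtain ⟨k, rfl⟩ := Nat.exists_eq_add_of_le h
  rw [Fin.sum_univ_add]
  simp [pad]

/-- Strict subadditivity of `x, y ↦ (x² + y²)^{1/2}`, summed over the aligned entries. -/
theorem sum_sqrt_sq_add_sq_lt (hp : 0 < p) (hq : 0 < q) {g₁ : Fin p → ℝ} {g₂ : Fin q → ℝ}
    (hg₁ : ∀ i, 0 < g₁ i) (hg₂ : ∀ i, 0 < g₂ i) :
    ∑ j : Fin (p + q), √(pad g₁ j ^ 2 + pad g₂ j ^ 2) < ∑ i, g₁ i + ∑ i, g₂ i := by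
  rw [← sum_pad (Nat.le_add_right p q) g₁, ← sum_pad (Nat.le_add_left q p) g₂,
    ← Finset.sum_add_distrib]
  have hn₁ := pad_nonneg fun i => (hg₁ i).le
  have hn₂ := pad_nonneg fun i => (hg₂ i).le
  -- Strictness comes from index 0, where both padded sequences are positive because `p` and `q`
  -- are.
  refine Finset.sum_lt_sum (fun j _ => ?_) ⟨⟨0, by omega⟩, Finset.mem_univ _, ?_⟩
  · rw [Real.sqrt_le_left (add_nonneg (hn₁ j) (hn₂ j))]
    nlinarith [mul_nonneg (hn₁ j) (hn₂ j)]
  · have h1 : 0 < pad g₁ 0 := by simp [pad, hp, hg₁]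
    have h2 : 0 < pad g₂ 0 := by simp [pad, hq, hg₂]
    rw [Real.sqrt_lt' (by positivity)]
    simp only
    nlinarith [mul_pos h1 h2]

theorem c₁_pos (hp : 0 < p) (hq : 0 < q) (hS : S.PosSemidef)
    (h₁ : IsOrderedEigendecomp S.toBlocks₁₁ U₁ l₁)
    (h₂ : IsOrderedEigendecomp S.toBlocks₂₂ U₂ l₂) (hl₁ : ∀ i, 0 < l₁ i) (hl₂ : ∀ i, 0 < l₂ i) :
    0 < c₁ S U₁ l₁ U₂ l₂ := by
  rw [c₁_eq hS h₁ h₂ hl₁ hl₂, sub_pos, trace_msqrt_blockDiagPart hS, h₁.msqrt_eq hl₁,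
    h₂.msqrt_eq hl₂, trace_orthogonal_conj (transpose_mul_self_of_orthogonal h₁.orthogonal),
    trace_orthogonal_conj (transpose_mul_self_of_orthogonal h₂.orthogonal),
    Matrix.trace_diagonal, Matrix.trace_diagonal]
  have := sum_sqrt_sq_add_sq_lt hp hq (fun i => Real.sqrt_pos.mpr (hl₁ i))
    (fun i => Real.sqrt_pos.mpr (hl₂ i))
  simpa only [pad_comp Real.sqrt Real.sqrt_zero, Real.sq_sqrt (pad_nonneg (fun i => (hl₁ i).le) _),
    Real.sq_sqrt (pad_nonneg (fun i => (hl₂ i).le) _)] using this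

theorem c₂_pos (hp : 0 < p) (hq : 0 < q) (hS : S.PosSemidef)
    (h₁ : IsOrderedEigendecomp S.toBlocks₁₁ U₁ l₁)
    (h₂ : IsOrderedEigendecomp S.toBlocks₂₂ U₂ l₂) (hl₁ : ∀ i, 0 < l₁ i) (hl₂ : ∀ i, 0 < l₂ i) :
    0 < c₂ S U₁ l₁ U₂ l₂ := by
  rw [c₂_eq hS h₁ h₂ hl₁ hl₂, sub_pos, trace_eq_add_toBlocks, h₁.eq,
    h₂.eq, trace_orthogonal_conj (transpose_mul_self_of_orthogonal h₁.orthogonal),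
    trace_orthogonal_conj (transpose_mul_self_of_orthogonal h₂.orthogonal),
    Matrix.trace_diagonal, Matrix.trace_diagonal]
  exact sum_sqrt_sq_add_sq_lt hp hq hl₁ hl₂

end Extremal

end Coefficients
-- One-sided calculus along matrix paths.
section Paths

theorem hasDerivWithinAt_Ioi_zero_iff {f : ℝ → ℝ} {d : ℝ} :
    HasDerivWithinAt f d (Set.Ioi 0) 0 ↔
      Tendsto (fun t => t⁻¹ * (f t - f 0)) (𝓝[>] 0) (𝓝 d) := by
  rw [hasDerivWithinAt_iff_tendsto_slope' (by simp)]
  simp [slope_fun_def]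

theorem tendsto_slope_matrix_iff {m n : Type} {A : ℝ → Matrix m n ℝ} {A' : Matrix m n ℝ} :
    Tendsto (fun t => t⁻¹ • (A t - A 0)) (𝓝[>] 0) (𝓝 A') ↔
      ∀ i j, HasDerivWithinAt (fun t => A t i j) (A' i j) (Set.Ioi 0) 0 := by
  simp only [hasDerivWithinAt_Ioi_zero_iff]
  constructor
  · intro h i j
    exact tendsto_pi_nhds.mp (tendsto_pi_nhds.mp h i) j
  · intro h
    exact tendsto_pi_nhds.mpr fun i => tendsto_pi_nhds.mpr fun j => h i j

theorem tendsto_of_tendsto_slope {m n : Type} {A : ℝ → Matrix m n ℝ} {A' : Matrix m n ℝ}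
    (h : Tendsto (fun t => t⁻¹ • (A t - A 0)) (𝓝[>] 0) (𝓝 A')) :
    Tendsto A (𝓝[>] 0) (𝓝 (A 0)) := by
  rw [tendsto_slope_matrix_iff] at h
  exact tendsto_pi_nhds.mpr fun i => tendsto_pi_nhds.mpr fun j => (h i j).continuousWithinAt

theorem posDef_one_add_of_sum_abs_lt_one {n : Type} [Fintype n] [DecidableEq n]
    {E : Matrix n n ℝ} (hE : E.IsHermitian) (h : ∑ i, ∑ j, |E i j| < 1) : (1 + E).PosDef := by
  refine .of_dotProduct_mulVec_pos (Matrix.isHermitian_one.add hE) fun x hx => ?_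
  set s := ∑ i, x i ^ 2 with hs
  have hs0 : 0 < s := by
    obtain ⟨i, hi⟩ := Function.ne_iff.mp hx
    exact Finset.sum_pos' (fun _ _ => sq_nonneg _) ⟨i, Finset.mem_univ i, by
      have : x i ≠ 0 := hi
      positivity⟩
  -- Each product `x i * x j` is at most `s` in absolute value, so the perturbation costs less than
  -- the `s` contributed by the identity.
  have hle : ∀ i, x i ^ 2 ≤ s := fun i =>
    Finset.single_le_sum (f := fun i => x i ^ 2) (fun _ _ => sq_nonneg _) (Finset.mem_univ i)
  have hexp : star x ⬝ᵥ (1 + E).mulVec x = s + ∑ i, ∑ j, E i j * (x i * x j) := by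
    rw [Matrix.add_mulVec, Matrix.one_mulVec, dotProduct_add, star_trivial]
    congr 1
    · simp [dotProduct, hs, sq]
    · simp only [dotProduct, Matrix.mulVec, Finset.mul_sum]
      exact Finset.sum_congr rfl fun i _ => Finset.sum_congr rfl fun j _ => by ring
  have hlow : -((∑ i, ∑ j, |E i j|) * s) ≤ ∑ i, ∑ j, E i j * (x i * x j) := by
    rw [Finset.sum_mul, ← Finset.sum_neg_distrib]
    refine Finset.sum_le_sum fun i _ => ?_
    rw [Finset.sum_mul, ← Finset.sum_neg_distrib]
    refine Finset.sum_le_sum fun j _ => ?_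
    refine (neg_le_neg ?_).trans (neg_abs_le _)
    rw [abs_mul]
    refine mul_le_mul_of_nonneg_left (abs_le.mpr ⟨?_, ?_⟩) (abs_nonneg _)
    · nlinarith [sq_nonneg (x i + x j), hle i, hle j]
    · nlinarith [sq_nonneg (x i - x j), hle i, hle j]
  rw [hexp]
  nlinarith

/-- Congruence by `B^{-1/2}` reduces the claim to a small symmetric perturbation of the identity. -/
theorem eventually_posDef {ι : Type*} {F : Filter ι} {n : Type} [Fintype n] [DecidableEq n]
    {A : ι → Matrix n n ℝ} {B : Matrix n n ℝ} (h : Tendsto A F (𝓝 B))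
    (hA : ∀ᶠ t in F, (A t).IsHermitian) (hB : B.PosDef) : ∀ᶠ t in F, (A t).PosDef := by
  have hu := isUnit_det_msqrt hB
  set C := (msqrt B)⁻¹ with hC
  have hCt : C.transpose = C := by rw [hC, Matrix.transpose_nonsing_inv, msqrt_transpose]
  set E : ι → Matrix n n ℝ := fun t => C * (A t - B) * C with hE
  have hE0 : Tendsto (fun t => ∑ i, ∑ j, |E t i j|) F (𝓝 0) := by
    have h1 : Tendsto E F (𝓝 (C * (B - B) * C)) :=
      (tendsto_const_nhds.mul (h.sub_const _)).mul tendsto_const_nhds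
    rw [sub_self, Matrix.mul_zero, Matrix.zero_mul] at h1
    have h2 : Tendsto (fun t => ∑ i, ∑ j, |E t i j|) F
        (𝓝 (∑ i, ∑ j, |(0 : Matrix n n ℝ) i j|)) :=
      tendsto_finsetSum _ fun i _ => tendsto_finsetSum _ fun j _ =>
        (tendsto_pi_nhds.mp (tendsto_pi_nhds.mp h1 i) j).abs
    simpa using h2
  filter_upwards [hA, hE0.eventually_lt_const one_pos] with t ht hlt
  have hEh : (E t).IsHermitian := by
    have h1 := Matrix.isHermitian_conjTranspose_mul_mul C (ht.sub hB.isHermitian)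
    rwa [Matrix.conjTranspose_eq_transpose_of_trivial, hCt] at h1
  have h1 := posDef_symm_conj (msqrt_transpose B) (msqrt_posDef hB).isUnit
    (posDef_one_add_of_sum_abs_lt_one hEh hlt)
  have h2 : msqrt B * (1 + E t) * msqrt B = A t := by
    rw [Matrix.mul_add, Matrix.add_mul, Matrix.mul_one, msqrt_mul_self hB.posSemidef]
    have : msqrt B * E t * msqrt B = A t - B := by
      calc _ = (msqrt B * C) * (A t - B) * (C * msqrt B) := by
            simp only [hE, Matrix.mul_assoc]
        _ = _ := by
            rw [hC, Matrix.mul_nonsing_inv _ hu, Matrix.nonsing_inv_mul _ hu, Matrix.one_mul,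
              Matrix.mul_one]
    rw [this, add_sub_cancel]
  rwa [h2] at h1

theorem msqrt_one {n : Type} [Fintype n] [DecidableEq n] : msqrt (1 : Matrix n n ℝ) = 1 :=
  msqrt_unique (Matrix.mul_one 1) Matrix.PosSemidef.one

theorem hasDerivWithinAt_fidelity {n : Type} [Fintype n] [DecidableEq n]
    {A B : ℝ → Matrix n n ℝ} {A' B' : Matrix n n ℝ}
    (hA : Tendsto (fun t => t⁻¹ • (A t - A 0)) (𝓝[>] 0) (𝓝 A'))
    (hB : Tendsto (fun t => t⁻¹ • (B t - B 0)) (𝓝[>] 0) (𝓝 B'))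
    (hAp : ∀ᶠ t in 𝓝[>] 0, (A t).PosDef) (hBp : ∀ᶠ t in 𝓝[>] 0, (B t).PosDef)
    (hA₀ : (A 0).PosDef) (hB₀ : (B 0).PosDef) :
    HasDerivWithinAt (fun t => fidelity (A t) (B t))
      (((transportMap (A 0) (B 0) * A').trace +
        ((transportMap (A 0) (B 0))⁻¹ * B').trace) / 2) (Set.Ioi 0) 0 :=
  hasDerivWithinAt_Ioi_zero_iff.mpr (tendsto_slope_fidelity hA hB (tendsto_of_tendsto_slope hA)
    (tendsto_of_tendsto_slope hB) hAp hBp hA₀ hB₀)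

theorem hasDerivWithinAt_trace_msqrt {n : Type} [Fintype n] [DecidableEq n]
    {B : ℝ → Matrix n n ℝ} {B' : Matrix n n ℝ}
    (hB : Tendsto (fun t => t⁻¹ • (B t - B 0)) (𝓝[>] 0) (𝓝 B'))
    (hBp : ∀ᶠ t in 𝓝[>] 0, (B t).PosDef) (hB₀ : (B 0).PosDef) :
    HasDerivWithinAt (fun t => (msqrt (B t)).trace) (((msqrt (B 0))⁻¹ * B').trace / 2)
      (Set.Ioi 0) 0 := by
  have h := hasDerivWithinAt_fidelity (A := fun _ => (1 : Matrix n n ℝ)) (A' := 0)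
    (by simp) hB (.of_forall fun _ => Matrix.PosDef.one) hBp Matrix.PosDef.one hB₀
  simpa [fidelity, transportMap, msqrt_one] using h

theorem hasDerivWithinAt_trace {n : Type} [Fintype n]
    {B : ℝ → Matrix n n ℝ} {B' : Matrix n n ℝ}
    (hB : Tendsto (fun t => t⁻¹ • (B t - B 0)) (𝓝[>] 0) (𝓝 B')) :
    HasDerivWithinAt (fun t => (B t).trace) B'.trace (Set.Ioi 0) 0 := by
  rw [tendsto_slope_matrix_iff] at hB
  simp only [Matrix.trace, Matrix.diag_apply]
  exact HasDerivWithinAt.fun_sum fun i _ => hB i i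

end Paths

/-! ### Derivatives of the eigenvalue sums. -/

section EigenvalueFunctionals

variable {p q : ℕ}

theorem sum_pad_mul {n d : ℕ} (h : n ≤ d) (k : Fin n → ℝ) (g : ℕ → ℝ) :
    ∑ j : Fin d, pad k j * g j = ∑ i, k i * g i := by
  rw [← sum_pad h fun i => k i * g i]
  refine Finset.sum_congr rfl fun j _ => ?_
  unfold pad
  split_ifs <;> simp

theorem hasDerivWithinAt_pad {n : ℕ} {l : ℝ → Fin n → ℝ} {k : Fin n → ℝ}
    (h : ∀ i, HasDerivWithinAt (fun t => l t i) (k i) (Set.Ioi 0) 0) (j : ℕ) :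
    HasDerivWithinAt (fun t => pad (l t) j) (pad k j) (Set.Ioi 0) 0 := by
  unfold pad
  split_ifs with hj
  · exact h _
  · exact hasDerivWithinAt_const _ _ _

theorem pad_eq_zero {n : ℕ} (l : Fin n → ℝ) {j : ℕ} (h : n ≤ j) : pad l j = 0 := by
  simp [pad, h]

theorem pad_pos {n : ℕ} {l : Fin n → ℝ} (hl : ∀ i, 0 < l i) {j : ℕ} (h : j < n) :
    0 < pad l j := by
  simp [pad, h, hl]

theorem hasDerivWithinAt_sum_sqrt_add {l₁ : ℝ → Fin p → ℝ} {l₂ : ℝ → Fin q → ℝ} {k₁ : Fin p → ℝ}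
    {k₂ : Fin q → ℝ} (h₁ : ∀ i, HasDerivWithinAt (fun t => l₁ t i) (k₁ i) (Set.Ioi 0) 0)
    (h₂ : ∀ i, HasDerivWithinAt (fun t => l₂ t i) (k₂ i) (Set.Ioi 0) 0)
    (hl₁ : ∀ i, 0 < l₁ 0 i) (hl₂ : ∀ i, 0 < l₂ 0 i) :
    HasDerivWithinAt (fun t => ∑ j : Fin (p + q), √(pad (l₁ t) j + pad (l₂ t) j))
      (((∑ i, k₁ i * (√(pad (l₁ 0) i + pad (l₂ 0) i))⁻¹) +
        ∑ i, k₂ i * (√(pad (l₁ 0) i + pad (l₂ 0) i))⁻¹) / 2) (Set.Ioi 0) 0 := by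
  rw [← sum_pad_mul (Nat.le_add_right p q) k₁ fun j => (√(pad (l₁ 0) j + pad (l₂ 0) j))⁻¹,
    ← sum_pad_mul (Nat.le_add_left q p) k₂ fun j => (√(pad (l₁ 0) j + pad (l₂ 0) j))⁻¹,
    ← Finset.sum_add_distrib, Finset.sum_div]
  refine HasDerivWithinAt.fun_sum fun j _ => ?_
  have hn₁ := pad_nonneg (fun i => (hl₁ i).le) j
  have hn₂ := pad_nonneg (fun i => (hl₂ i).le) j
  by_cases hj : (j : ℕ) < p ∨ (j : ℕ) < q
  · have hpos : 0 < pad (l₁ 0) j + pad (l₂ 0) j := by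
      rcases hj with hj | hj
      · linarith [pad_pos hl₁ hj]
      · linarith [pad_pos hl₂ hj]
    have := ((hasDerivWithinAt_pad h₁ j).fun_add (hasDerivWithinAt_pad h₂ j)).sqrt hpos.ne'
    refine this.congr_deriv ?_
    rw [← add_mul, ← div_eq_mul_inv, div_div, mul_comm (√_)]
  -- Beyond both lengths the summand is identically zero, so the singularity of the square root at 0
  -- is never met.
  · push Not at hj
    simp only [pad_eq_zero _ hj.1, pad_eq_zero _ hj.2]
    simpa using hasDerivWithinAt_const (0 : ℝ) (Set.Ioi 0) (0 : ℝ)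

theorem hasDerivWithinAt_sum_sqrt_sq_add_sq {l₁ : ℝ → Fin p → ℝ} {l₂ : ℝ → Fin q → ℝ}
    {k₁ : Fin p → ℝ} {k₂ : Fin q → ℝ}
    (h₁ : ∀ i, HasDerivWithinAt (fun t => l₁ t i) (k₁ i) (Set.Ioi 0) 0)
    (h₂ : ∀ i, HasDerivWithinAt (fun t => l₂ t i) (k₂ i) (Set.Ioi 0) 0)
    (hl₁ : ∀ i, 0 < l₁ 0 i) (hl₂ : ∀ i, 0 < l₂ 0 i) :
    HasDerivWithinAt (fun t => ∑ j : Fin (p + q), √(pad (l₁ t) j ^ 2 + pad (l₂ t) j ^ 2))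
      ((∑ i, k₁ i * ((√(pad (l₁ 0) i ^ 2 + pad (l₂ 0) i ^ 2))⁻¹ * pad (l₁ 0) i)) +
        ∑ i, k₂ i * ((√(pad (l₁ 0) i ^ 2 + pad (l₂ 0) i ^ 2))⁻¹ * pad (l₂ 0) i))
      (Set.Ioi 0) 0 := by
  have h₁' : ∀ i, HasDerivWithinAt (fun t => l₁ t i ^ 2) (2 * l₁ 0 i * k₁ i) (Set.Ioi 0) 0 :=
    fun i => by simpa using (h₁ i).fun_pow 2
  have h₂' : ∀ i, HasDerivWithinAt (fun t => l₂ t i ^ 2) (2 * l₂ 0 i * k₂ i) (Set.Ioi 0) 0 :=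
    fun i => by simpa using (h₂ i).fun_pow 2
  have := hasDerivWithinAt_sum_sqrt_add (l₁ := fun t i => l₁ t i ^ 2)
    (l₂ := fun t i => l₂ t i ^ 2) h₁' h₂' (fun i => pow_pos (hl₁ i) 2) (fun i => pow_pos (hl₂ i) 2)
  simp only [fun l : Fin p → ℝ => pad_comp (· ^ 2) (by simp) l,
    fun l : Fin q → ℝ => pad_comp (· ^ 2) (by simp) l] at this
  refine this.congr_deriv ?_
  rw [add_div, Finset.sum_div, Finset.sum_div]
  congr 1 <;>
  · refine Finset.sum_congr rfl fun i _ => ?_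
    simp only [pad, Fin.is_lt, dif_pos, Fin.eta]
    ring

/-- The diagonal entries of `Uᵀ K U` are the eigenvalue derivatives, so this collects their weighted
sum into one trace against `K`. -/
theorem trace_orthogonal_diagonal_mul {n : ℕ} (U K : Matrix (Fin n) (Fin n) ℝ) (d : Fin n → ℝ) :
    (U * Matrix.diagonal d * U.transpose * K).trace =
      ∑ i, (U.transpose * K * U) i i * d i := by
  rw [Matrix.mul_assoc, Matrix.mul_assoc, Matrix.trace_mul_comm, Matrix.mul_assoc, Matrix.trace]
  refine Finset.sum_congr rfl fun i _ => ?_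
  rw [Matrix.diag_apply, Matrix.diagonal_mul, mul_comm]

theorem trace_fromBlocks_diag_mul (A : Matrix (Fin p) (Fin p) ℝ) (B : Matrix (Fin q) (Fin q) ℝ)
    (K : Matrix (Fin p ⊕ Fin q) (Fin p ⊕ Fin q) ℝ) :
    (Matrix.fromBlocks A 0 0 B * K).trace =
      (A * K.toBlocks₁₁).trace + (B * K.toBlocks₂₂).trace := by
  conv_lhs => rw [← Matrix.fromBlocks_toBlocks K, Matrix.fromBlocks_multiply]
  rw [trace_eq_add_toBlocks]
  simp

end EigenvalueFunctionals
-- Derivatives of the two coefficients.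
section Derivatives

variable {p q : ℕ}

theorem tendsto_slope_toBlocks₁₁ {S : ℝ → Matrix (Fin p ⊕ Fin q) (Fin p ⊕ Fin q) ℝ}
    {K : Matrix (Fin p ⊕ Fin q) (Fin p ⊕ Fin q) ℝ}
    (hS : Tendsto (fun t => t⁻¹ • (S t - S 0)) (𝓝[>] 0) (𝓝 K)) :
    Tendsto (fun t => t⁻¹ • ((S t).toBlocks₁₁ - (S 0).toBlocks₁₁)) (𝓝[>] 0)
      (𝓝 K.toBlocks₁₁) := by
  rw [tendsto_slope_matrix_iff] at hS
  exact tendsto_slope_matrix_iff (A := fun t => (S t).toBlocks₁₁).mpr fun i j => hS _ _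

theorem tendsto_slope_toBlocks₂₂ {S : ℝ → Matrix (Fin p ⊕ Fin q) (Fin p ⊕ Fin q) ℝ}
    {K : Matrix (Fin p ⊕ Fin q) (Fin p ⊕ Fin q) ℝ}
    (hS : Tendsto (fun t => t⁻¹ • (S t - S 0)) (𝓝[>] 0) (𝓝 K)) :
    Tendsto (fun t => t⁻¹ • ((S t).toBlocks₂₂ - (S 0).toBlocks₂₂)) (𝓝[>] 0)
      (𝓝 K.toBlocks₂₂) := by
  rw [tendsto_slope_matrix_iff] at hS
  exact tendsto_slope_matrix_iff (A := fun t => (S t).toBlocks₂₂).mpr fun i j => hS _ _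

theorem tendsto_slope_blockDiagPart {S : ℝ → Matrix (Fin p ⊕ Fin q) (Fin p ⊕ Fin q) ℝ}
    {K : Matrix (Fin p ⊕ Fin q) (Fin p ⊕ Fin q) ℝ}
    (hS : Tendsto (fun t => t⁻¹ • (S t - S 0)) (𝓝[>] 0) (𝓝 K)) :
    Tendsto (fun t => t⁻¹ • (blockDiagPart (S t) - blockDiagPart (S 0))) (𝓝[>] 0)
      (𝓝 (blockDiagPart K)) := by
  rw [tendsto_slope_matrix_iff] at hS
  refine tendsto_slope_matrix_iff (A := fun t => blockDiagPart (S t)).mpr fun i j => ?_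
  rcases i with a | b <;> rcases j with a' | b'
  · exact hS _ _
  · exact hasDerivWithinAt_const _ _ _
  · exact hasDerivWithinAt_const _ _ _
  · exact hS _ _

/-- Taking the block diagonal part is self-adjoint for the trace pairing; this is the source of `J₀`
in `M₂`. -/
theorem trace_mul_blockDiagPart (M K : Matrix (Fin p ⊕ Fin q) (Fin p ⊕ Fin q) ℝ) :
    (M * blockDiagPart K).trace = (blockDiagPart M * K).trace := by
  rw [Matrix.trace_mul_comm, blockDiagPart, blockDiagPart, trace_fromBlocks_diag_mul,
    trace_fromBlocks_diag_mul, Matrix.trace_mul_comm, Matrix.trace_mul_comm K.toBlocks₂₂]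

theorem blockDiagPart_inv_msqrt {S : Matrix (Fin p ⊕ Fin q) (Fin p ⊕ Fin q) ℝ} (hS : S.PosDef) :
    blockDiagPart (msqrt (blockDiagPart S))⁻¹ = (msqrt (blockDiagPart S))⁻¹ := by
  have h : (msqrt (blockDiagPart S))⁻¹ =
      Matrix.fromBlocks (msqrt S.toBlocks₁₁)⁻¹ 0 0 (msqrt S.toBlocks₂₂)⁻¹ := by
    rw [msqrt_blockDiagPart hS.posSemidef]
    refine Matrix.inv_eq_right_inv ?_
    simp [Matrix.fromBlocks_multiply,
      Matrix.mul_nonsing_inv _ (isUnit_det_msqrt (toBlocks₁₁_posDef hS)),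
      Matrix.mul_nonsing_inv _ (isUnit_det_msqrt (toBlocks₂₂_posDef hS))]
  rw [h]
  rfl

/-- Along a path of symmetric matrices, ordered eigenvalues can be chosen with the given
decomposition at time zero and with one-sided derivatives there. -/
theorem exists_eigenvalue_path {n : ℕ} {A : ℝ → Matrix (Fin n) (Fin n) ℝ}
    {A' U₀ : Matrix (Fin n) (Fin n) ℝ} {l₀ : Fin n → ℝ} (hA : ∀ t, 0 < t → (A t).IsHermitian)
    (hA₀ : IsOrderedEigendecomp (A 0) U₀ l₀) (hinj : Function.Injective l₀)
    (hs : Tendsto (fun t => t⁻¹ • (A t - A 0)) (𝓝[>] 0) (𝓝 A')) :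
    ∃ (U : ℝ → Matrix (Fin n) (Fin n) ℝ) (l : ℝ → Fin n → ℝ), l 0 = l₀ ∧
      (∀ t, 0 < t → IsOrderedEigendecomp (A t) (U t) (l t)) ∧
      ∀ i, HasDerivWithinAt (fun t => l t i) ((U₀.transpose * A' * U₀) i i) (Set.Ioi 0) 0 := by
  -- For `t > 0` any ordered decomposition will do; only the value at `t = 0` is pinned to the given
  -- eigenvalues.
  have hex : ∀ t : ℝ, ∃ (U : Matrix (Fin n) (Fin n) ℝ) (l : Fin n → ℝ),
      (t = 0 → l = l₀) ∧ (0 < t → IsOrderedEigendecomp (A t) U l) := by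
    intro t
    by_cases ht : 0 < t
    · obtain ⟨U, l, h⟩ := exists_orderedEigendecomp (hA t ht)
      exact ⟨U, l, fun h0 => absurd h0 ht.ne', fun _ => h⟩
    · exact ⟨U₀, l₀, fun _ => rfl, fun h => absurd h ht⟩
  choose U l h0 hpos using hex
  refine ⟨U, l, h0 0 rfl, hpos, fun i => hasDerivWithinAt_Ioi_zero_iff.mpr ?_⟩
  rw [h0 0 rfl]
  refine tendsto_slope_eigenvalue (U := U) ?_ hA₀ hinj (tendsto_of_tendsto_slope hs) hs i
  filter_upwards [self_mem_nhdsWithin] with t ht using hpos t ht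

variable {S : ℝ → Matrix (Fin p ⊕ Fin q) (Fin p ⊕ Fin q) ℝ}
  {K : Matrix (Fin p ⊕ Fin q) (Fin p ⊕ Fin q) ℝ}
  {U₁ : Matrix (Fin p) (Fin p) ℝ} {l₁ : Fin p → ℝ} {U₂ : Matrix (Fin q) (Fin q) ℝ}
  {l₂ : Fin q → ℝ}

/-- One-sided derivative of the first coefficient along a path of symmetric matrices. -/
theorem hasDerivWithinAt_dep₁ (hp : 0 < p) (hq : 0 < q)
    (hsymm : ∀ t, 0 < t → (S t).IsHermitian) (hS₀ : (S 0).PosDef)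
    (hS : Tendsto (fun t => t⁻¹ • (S t - S 0)) (𝓝[>] 0) (𝓝 K))
    (h₁ : IsOrderedEigendecomp (S 0).toBlocks₁₁ U₁ l₁)
    (h₂ : IsOrderedEigendecomp (S 0).toBlocks₂₂ U₂ l₂)
    (hdist₁ : Function.Injective l₁) (hdist₂ : Function.Injective l₂) :
    HasDerivWithinAt (fun t => dep₁ (S t)) (M₁ (S 0) U₁ l₁ U₂ l₂ * K).trace (Set.Ioi 0) 0 := by
  have hl₁ := h₁.pos (toBlocks₁₁_posDef hS₀)
  have hl₂ := h₂.pos (toBlocks₂₂_posDef hS₀)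
  have hpd : ∀ᶠ t in 𝓝[>] 0, (S t).PosDef := by
    refine eventually_posDef (tendsto_of_tendsto_slope hS) ?_ hS₀
    filter_upwards [self_mem_nhdsWithin] with t ht using hsymm t ht
  obtain ⟨V₁, m₁, hm₁, hV₁, hd₁⟩ := exists_eigenvalue_path (A := fun t => (S t).toBlocks₁₁)
    (fun t ht => (hsymm t ht).submatrix _) h₁ hdist₁ (tendsto_slope_toBlocks₁₁ hS)
  obtain ⟨V₂, m₂, hm₂, hV₂, hd₂⟩ := exists_eigenvalue_path (A := fun t => (S t).toBlocks₂₂)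
    (fun t ht => (hsymm t ht).submatrix _) h₂ hdist₂ (tendsto_slope_toBlocks₂₂ hS)
  have hR := hasDerivWithinAt_trace_msqrt hS hpd hS₀
  have hR₀ := hasDerivWithinAt_trace_msqrt (tendsto_slope_blockDiagPart hS)
    (hpd.mono fun t ht => blockDiagPart_posDef ht) (blockDiagPart_posDef hS₀)
  have hG := hasDerivWithinAt_sum_sqrt_add hd₁ hd₂ (fun i => hm₁ ▸ hl₁ i) (fun i => hm₂ ▸ hl₂ i)
  have hc := c₁_pos hp hq hS₀.posSemidef h₁ h₂ hl₁ hl₂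
  have hceq := c₁_eq hS₀.posSemidef h₁ h₂ hl₁ hl₂
  have hdep := dep₁_eq hp hq hS₀.posSemidef h₁ h₂ hl₁ hl₂
  have hdiv := (hR₀.fun_sub hR).fun_div (hR₀.fun_sub hG) (by rw [hm₁, hm₂, ← hceq]; exact hc.ne')
  rw [hm₁, hm₂, ← hceq] at hdiv
  have hdiv' := hdiv.congr_of_eventuallyEq (f₁ := fun t => dep₁ (S t)) (by
    filter_upwards [hpd, self_mem_nhdsWithin] with t ht htpos
    exact dep₁_eq hp hq ht.posSemidef (hV₁ t htpos) (hV₂ t htpos)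
      ((hV₁ t htpos).pos (toBlocks₁₁_posDef ht)) ((hV₂ t htpos).pos (toBlocks₂₂_posDef ht)))
    (by rw [hm₁, hm₂]; exact hdep)
  refine hdiv'.congr_deriv ?_
  have hU : (Upsilon₁ U₁ l₁ U₂ l₂ * K).trace =
      (∑ i, (U₁.transpose * K.toBlocks₁₁ * U₁) i i * (√(pad l₁ i + pad l₂ i))⁻¹) +
        ∑ i, (U₂.transpose * K.toBlocks₂₂ * U₂) i i * (√(pad l₁ i + pad l₂ i))⁻¹ := by
    rw [Upsilon₁, trace_fromBlocks_diag_mul, Delta, Delta, trace_orthogonal_diagonal_mul,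
      trace_orthogonal_diagonal_mul]
  rw [← hceq] at hdep
  rw [← hU, trace_mul_blockDiagPart, blockDiagPart_inv_msqrt hS₀, M₁]
  simp only [Matrix.smul_mul, Matrix.add_mul, Matrix.neg_mul, Matrix.trace_smul,
    Matrix.trace_add, Matrix.trace_neg, smul_eq_mul]
  -- With numerator `N = dep₁ · c₁` and denominator `c₁`, the quotient rule collapses to `(N' - dep₁
  -- · c₁') / c₁`, where `c₁'` is the derivative of the denominator.
  have hnum : (msqrt (blockDiagPart (S 0))).trace - (msqrt (S 0)).trace =
      dep₁ (S 0) * c₁ (S 0) U₁ l₁ U₂ l₂ := by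
    rw [hdep, div_mul_cancel₀ _ hc.ne']
  rw [hnum]
  have := hc.ne'
  field_simp
  ring

/-- One-sided derivative of the second coefficient along a path of symmetric matrices. -/
theorem hasDerivWithinAt_dep₂ (hp : 0 < p) (hq : 0 < q)
    (hsymm : ∀ t, 0 < t → (S t).IsHermitian) (hS₀ : (S 0).PosDef)
    (hS : Tendsto (fun t => t⁻¹ • (S t - S 0)) (𝓝[>] 0) (𝓝 K))
    (h₁ : IsOrderedEigendecomp (S 0).toBlocks₁₁ U₁ l₁)
    (h₂ : IsOrderedEigendecomp (S 0).toBlocks₂₂ U₂ l₂)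
    (hdist₁ : Function.Injective l₁) (hdist₂ : Function.Injective l₂) :
    HasDerivWithinAt (fun t => dep₂ (S t)) (M₂ (S 0) U₁ l₁ U₂ l₂ * K).trace (Set.Ioi 0) 0 := by
  have hl₁ := h₁.pos (toBlocks₁₁_posDef hS₀)
  have hl₂ := h₂.pos (toBlocks₂₂_posDef hS₀)
  have hpd : ∀ᶠ t in 𝓝[>] 0, (S t).PosDef := by
    refine eventually_posDef (tendsto_of_tendsto_slope hS) ?_ hS₀
    filter_upwards [self_mem_nhdsWithin] with t ht using hsymm t ht
  obtain ⟨V₁, m₁, hm₁, hV₁, hd₁⟩ := exists_eigenvalue_path (A := fun t => (S t).toBlocks₁₁)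
    (fun t ht => (hsymm t ht).submatrix _) h₁ hdist₁ (tendsto_slope_toBlocks₁₁ hS)
  obtain ⟨V₂, m₂, hm₂, hV₂, hd₂⟩ := exists_eigenvalue_path (A := fun t => (S t).toBlocks₂₂)
    (fun t ht => (hsymm t ht).submatrix _) h₂ hdist₂ (tendsto_slope_toBlocks₂₂ hS)
  have hT := hasDerivWithinAt_trace hS
  -- Both arguments of the fidelity move: the block diagonal part is paired with `J`, the matrix
  -- itself with `J⁻¹`.
  have hF := hasDerivWithinAt_fidelity (tendsto_slope_blockDiagPart hS) hS
    (hpd.mono fun t ht => blockDiagPart_posDef ht) hpd (blockDiagPart_posDef hS₀) hS₀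
  have hG := hasDerivWithinAt_sum_sqrt_sq_add_sq hd₁ hd₂ (fun i => hm₁ ▸ hl₁ i)
    (fun i => hm₂ ▸ hl₂ i)
  have hc := c₂_pos hp hq hS₀.posSemidef h₁ h₂ hl₁ hl₂
  have hceq := c₂_eq hS₀.posSemidef h₁ h₂ hl₁ hl₂
  have hdep := dep₂_eq hp hq hS₀.posSemidef h₁ h₂ hl₁ hl₂
  have hdiv := (hT.fun_sub hF).fun_div (hT.fun_sub hG) (by rw [hm₁, hm₂, ← hceq]; exact hc.ne')
  rw [hm₁, hm₂, ← hceq] at hdiv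
  have hdiv' := hdiv.congr_of_eventuallyEq (f₁ := fun t => dep₂ (S t)) (by
    filter_upwards [hpd, self_mem_nhdsWithin] with t ht htpos
    exact dep₂_eq hp hq ht.posSemidef (hV₁ t htpos) (hV₂ t htpos)
      ((hV₁ t htpos).pos (toBlocks₁₁_posDef ht)) ((hV₂ t htpos).pos (toBlocks₂₂_posDef ht)))
    (by rw [hm₁, hm₂]; exact hdep)
  refine hdiv'.congr_deriv ?_
  have hU : (Upsilon₂ U₁ l₁ U₂ l₂ * K).trace =
      (∑ i, (U₁.transpose * K.toBlocks₁₁ * U₁) i i *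
        ((√(pad l₁ i ^ 2 + pad l₂ i ^ 2))⁻¹ * pad l₁ i)) +
        ∑ i, (U₂.transpose * K.toBlocks₂₂ * U₂) i i *
          ((√(pad l₁ i ^ 2 + pad l₂ i ^ 2))⁻¹ * pad l₂ i) := by
    rw [Upsilon₂, trace_fromBlocks_diag_mul, Delta₁', Delta₂', trace_orthogonal_diagonal_mul,
      trace_orthogonal_diagonal_mul]
  have hJ : transportMap (blockDiagPart (S 0)) (S 0) = Jmat (S 0) := rfl
  rw [← hceq] at hdep
  rw [← hU, hJ, trace_mul_blockDiagPart, M₂]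
  simp only [Matrix.smul_mul, Matrix.add_mul, Matrix.neg_mul, Matrix.trace_smul,
    Matrix.trace_add, Matrix.trace_neg, smul_eq_mul, Matrix.one_mul]
  have hnum : (S 0).trace - fidelity (blockDiagPart (S 0)) (S 0) =
      dep₂ (S 0) * c₂ (S 0) U₁ l₁ U₂ l₂ := by
    rw [hdep, div_mul_cancel₀ _ hc.ne']
  rw [hnum]
  have := hc.ne'
  field_simp
  ring

end Derivatives

/-! ### Normalisation to correlation matrices. -/

section Correlation

theorem toCorr_apply {n : Type} [Fintype n] [DecidableEq n] (S : Matrix n n ℝ) (i j : n) :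
    toCorr S i j = (√(S i i))⁻¹ * S i j * (√(S j j))⁻¹ := by
  rw [toCorr, Matrix.mul_diagonal, Matrix.diagonal_mul]

theorem toCorr_eq_self {n : Type} [Fintype n] [DecidableEq n] {R : Matrix n n ℝ}
    (hR : diagPart R = 1) : toCorr R = R := by
  have h1 : ∀ i, R i i = 1 := fun i => by
    simpa [diagPart] using congrFun (congrFun hR i) i
  ext i j
  simp [toCorr_apply, h1]

theorem toCorr_isHermitian {n : Type} [Fintype n] [DecidableEq n] {S : Matrix n n ℝ}
    (hS : S.IsSymm) : (toCorr S).IsHermitian := by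
  refine Matrix.IsHermitian.ext fun i j => ?_
  rw [toCorr_apply, toCorr_apply, hS.apply i j, star_trivial]
  ring

/-- One-sided derivative at a correlation matrix of the map to correlation matrices. -/
theorem tendsto_slope_toCorr {n : Type} [Fintype n] [DecidableEq n] {R H : Matrix n n ℝ}
    {Ht : ℝ → Matrix n n ℝ} (hR : diagPart R = 1) (hlim : Tendsto Ht (𝓝[>] 0) (𝓝 H)) :
    Tendsto (fun t => t⁻¹ • (toCorr (R + t • Ht t) - toCorr (R + (0 : ℝ) • Ht 0))) (𝓝[>] 0)
      (𝓝 (Matrix.of fun i j => H i j - (H i i + H j j) * R i j / 2)) := by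
  have h1 : ∀ i, R i i = 1 := fun i => by
    simpa [diagPart] using congrFun (congrFun hR i) i
  refine tendsto_slope_matrix_iff (A := fun t => toCorr (R + t • Ht t)).mpr fun i j => ?_
  have hent : ∀ i j, HasDerivWithinAt (fun t => (R + t • Ht t) i j) (H i j) (Set.Ioi 0) 0 := by
    intro i j
    rw [hasDerivWithinAt_Ioi_zero_iff]
    refine (tendsto_pi_nhds.mp (tendsto_pi_nhds.mp hlim i) j).congr' ?_
    filter_upwards [self_mem_nhdsWithin] with t ht
    have : t ≠ 0 := ne_of_gt ht
    simp [this]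
  have hinv : ∀ i, HasDerivWithinAt (fun t => (√((R + t • Ht t) i i))⁻¹) (-(H i i / 2))
      (Set.Ioi 0) 0 := by
    intro i
    have := ((hent i i).sqrt (by simp [h1])).fun_inv (by simp [h1])
    refine this.congr_deriv ?_
    simp [h1]
  simp only [toCorr_apply]
  refine (((hinv i).fun_mul (hent i j)).fun_mul (hinv j)).congr_deriv ?_
  simp [h1]
  ring

/-- The corrections with `H i i` and with `H j j` contribute equally: symmetry of `M` and `R` lets
the summation indices be exchanged, and each is half the trace against `diagPart (M * R)`. -/
theorem trace_mul_toCorr_deriv {n : Type} [Fintype n] [DecidableEq n] {M R : Matrix n n ℝ}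
    (hM : M.IsSymm) (hR : R.IsSymm) (H : Matrix n n ℝ) :
    (M * Matrix.of fun i j => H i j - (H i i + H j j) * R i j / 2).trace =
      ((M - diagPart (M * R)) * H).trace := by
  have h1 : (diagPart (M * R) * H).trace = ∑ i, ∑ j, M i j * R j i * H i i := by
    rw [Matrix.trace]
    refine Finset.sum_congr rfl fun i _ => ?_
    rw [Matrix.diag_apply, diagPart, Matrix.diagonal_mul, Matrix.diag_apply, Matrix.mul_apply,
      Finset.sum_mul]
  have h2 : (diagPart (M * R) * H).trace = ∑ i, ∑ j, M i j * R j i * H j j := by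
    rw [h1, Finset.sum_comm]
    refine Finset.sum_congr rfl fun i _ => Finset.sum_congr rfl fun j _ => ?_
    rw [hM.apply, hR.apply]
  have h3 : (M * H).trace = ∑ i, ∑ j, M i j * H j i := by
    simp [Matrix.trace, Matrix.mul_apply]
  have h4 : (M * Matrix.of fun i j => H i j - (H i i + H j j) * R i j / 2).trace =
      (M * H).trace - ((diagPart (M * R) * H).trace + (diagPart (M * R) * H).trace) / 2 := by
    nth_rewrite 1 [h1]
    rw [h2, h3, ← Finset.sum_add_distrib, Finset.sum_div, ← Finset.sum_sub_distrib, Matrix.trace]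
    refine Finset.sum_congr rfl fun i _ => ?_
    rw [← Finset.sum_add_distrib, Finset.sum_div, ← Finset.sum_sub_distrib, Matrix.diag_apply,
      Matrix.mul_apply]
    refine Finset.sum_congr rfl fun j _ => ?_
    rw [Matrix.of_apply]
    ring
  rw [h4, Matrix.sub_mul, Matrix.trace_sub]
  ring

variable {p q : ℕ}

theorem fromBlocks_conj_diagonal_isSymm (U₁ : Matrix (Fin p) (Fin p) ℝ)
    (U₂ : Matrix (Fin q) (Fin q) ℝ) (d₁ : Fin p → ℝ) (d₂ : Fin q → ℝ) :
    (Matrix.fromBlocks (U₁ * Matrix.diagonal d₁ * U₁.transpose) 0 0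
      (U₂ * Matrix.diagonal d₂ * U₂.transpose)).IsSymm := by
  simp [Matrix.IsSymm, Matrix.fromBlocks_transpose, Matrix.transpose_mul, Matrix.mul_assoc]

theorem M₁_isSymm (S : Matrix (Fin p ⊕ Fin q) (Fin p ⊕ Fin q) ℝ)
    (U₁ : Matrix (Fin p) (Fin p) ℝ) (l₁ : Fin p → ℝ)
    (U₂ : Matrix (Fin q) (Fin q) ℝ) (l₂ : Fin q → ℝ) : (M₁ S U₁ l₁ U₂ l₂).IsSymm := by
  have hi : ∀ A : Matrix (Fin p ⊕ Fin q) (Fin p ⊕ Fin q) ℝ, ((msqrt A)⁻¹).IsSymm := fun A => by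
    rw [Matrix.IsSymm, Matrix.transpose_nonsing_inv, msqrt_transpose]
  exact (((hi _).neg.add ((hi _).smul _)).add
    ((fromBlocks_conj_diagonal_isSymm _ _ _ _).smul _)).smul _

theorem M₂_isSymm {S : Matrix (Fin p ⊕ Fin q) (Fin p ⊕ Fin q) ℝ} (hS : S.PosDef)
    (U₁ : Matrix (Fin p) (Fin p) ℝ) (l₁ : Fin p → ℝ)
    (U₂ : Matrix (Fin q) (Fin q) ℝ) (l₂ : Fin q → ℝ) : (M₂ S U₁ l₁ U₂ l₂).IsSymm := by
  have hJ : (Jmat S).PosDef := transportMap_posDef (blockDiagPart_posDef hS) hS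
  have hJ₀ : (blockDiagPart (Jmat S)).IsSymm := (blockDiagPart_posDef hJ).posSemidef.transpose_eq
  have hJi : ((Jmat S)⁻¹).IsSymm := hJ.inv.posSemidef.transpose_eq
  exact ((((hJ₀.add hJi).smul _).neg.add (Matrix.isSymm_one.smul _)).add
    ((fromBlocks_conj_diagonal_isSymm _ _ _ _).smul _)).smul _

end Correlation
end QGDep

/-! ### The two limits. -/

theorem mainTheorem8 {p q : ℕ} (hp : 0 < p) (hq : 0 < q)
    (R : Matrix (Fin p ⊕ Fin q) (Fin p ⊕ Fin q) ℝ)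
    (hR : R.PosDef) (hcorr : QGDep.diagPart R = 1)
    (U₁ : Matrix (Fin p) (Fin p) ℝ) (l₁ : Fin p → ℝ)
    (U₂ : Matrix (Fin q) (Fin q) ℝ) (l₂ : Fin q → ℝ)
    (h₁ : QGDep.IsOrderedEigendecomp R.toBlocks₁₁ U₁ l₁)
    (h₂ : QGDep.IsOrderedEigendecomp R.toBlocks₂₂ U₂ l₂)
    (hdist₁ : Function.Injective l₁) (hdist₂ : Function.Injective l₂)
    (Ht : ℝ → Matrix (Fin p ⊕ Fin q) (Fin p ⊕ Fin q) ℝ)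
    (H : Matrix (Fin p ⊕ Fin q) (Fin p ⊕ Fin q) ℝ)
    (hHt : ∀ t : ℝ, 0 < t → (Ht t).IsSymm) (hH : H.IsSymm)
    (hlim : Tendsto Ht (𝓝[>] 0) (𝓝 H)) :
    Tendsto
      (fun t : ℝ => t⁻¹ * (QGDep.dep₁ (QGDep.toCorr (R + t • Ht t)) - QGDep.dep₁ R)) (𝓝[>] 0)
      (𝓝 (((QGDep.M₁ R U₁ l₁ U₂ l₂ -
        QGDep.diagPart (QGDep.M₁ R U₁ l₁ U₂ l₂ * R)) * H).trace)) ∧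
    Tendsto
      (fun t : ℝ => t⁻¹ * (QGDep.dep₂ (QGDep.toCorr (R + t • Ht t)) - QGDep.dep₂ R)) (𝓝[>] 0)
      (𝓝 (((QGDep.M₂ R U₁ l₁ U₂ l₂ -
        QGDep.diagPart (QGDep.M₂ R U₁ l₁ U₂ l₂ * R)) * H).trace)) := by
  have hRs : R.IsSymm := hR.posSemidef.transpose_eq
  -- The path is evaluated at `t = 0`, where `Ht 0` is unconstrained but multiplied by zero, so the
  -- path starts at `R`.
  have h0 : QGDep.toCorr (R + (0 : ℝ) • Ht 0) = R := by
    rw [zero_smul, add_zero, QGDep.toCorr_eq_self hcorr]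
  have hslope := QGDep.tendsto_slope_toCorr hcorr hlim
  have hherm : ∀ t : ℝ, 0 < t → (QGDep.toCorr (R + t • Ht t)).IsHermitian := fun t ht =>
    QGDep.toCorr_isHermitian (hRs.add ((hHt t ht).smul t))
  have d₁ := QGDep.hasDerivWithinAt_dep₁ (S := fun t => QGDep.toCorr (R + t • Ht t)) hp hq hherm
    (h0.symm ▸ hR) hslope (h0.symm ▸ h₁) (h0.symm ▸ h₂) hdist₁ hdist₂
  have d₂ := QGDep.hasDerivWithinAt_dep₂ (S := fun t => QGDep.toCorr (R + t • Ht t)) hp hq hherm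
    (h0.symm ▸ hR) hslope (h0.symm ▸ h₁) (h0.symm ▸ h₂) hdist₁ hdist₂
  rw [QGDep.hasDerivWithinAt_Ioi_zero_iff] at d₁ d₂
  simp only [h0] at d₁ d₂
  rw [QGDep.trace_mul_toCorr_deriv (QGDep.M₁_isSymm _ _ _ _ _) hRs] at d₁
  rw [QGDep.trace_mul_toCorr_deriv (QGDep.M₂_isSymm hR _ _ _ _) hRs] at d₂
  exact ⟨d₁, d₂⟩
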